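/- Let $G$ be a finite subgroup of $\mathrm{SL}(2,\mathbb C)$ and let $R=\mathbb C[u]$. Let $G$ act $R$-linearly on the free algebra $R\langle x,y\rangle$ by linear substitutions of $x,y$ (the span of $x,y$ being the natural two-dimensional representation of $G$). For $\tau$ in the centre $Z(RG)$ of the group algebra $RG$ put $$A^{\tau}=\bigl(R\langle x,y\rangle \# G\bigr)/(xy-yx-\tau),$$ let $e=|G|^{-1}\sum_{g\in G}g$, viewed as an element of $A^\tau$, and let $C^\tau=eA^\tau e$, an $R$-algebra with unit $e$. Write $Z(A^\tau)$ and $Z(C^\tau)$ for the centres. (1) For every $\tau\in Z(RG)$, the map $\phi\colon A^\tau\to C^\tau$, $\phi(a)=eae$, restricts to an isomorphism of $R$-algebras (in particular of $\mathbb C$-algebras) from $Z(A^\tau)$ onto $Z(C^\tau)$. (2) Let $\rho_0,\dots,\rho_n$ be the irreducible complex representations of $G$, let $\delta_i=\dim\rho_i$, fix an isomorphism $\mathbb CG\cong\prod_{i=0}^n \mathrm{Mat}_{\delta_i}(\mathbb C)$, and let $\varepsilon_i\in\mathbb CG$ be the central idempotent corresponding to the identity of the $i$-th factor. Let $\tau_0,\dots,\tau_n\in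 R$ be the unique elements with $\tau=\sum_i(\tau_i/\delta_i)\,\varepsilon_i$. If $\sum_i\delta_i\tau_i=0$, then $C^\tau$ is commutative and $\phi$ restricts to an isomorphism of $R$-algebras from $Z(A^\tau)$ onto $C^\tau$. -/

import Mathlib

open scoped Polynomial MatrixGroups

set_option linter.unusedSectionVars false

noncomputable section

namespace CBH

/-! ### Corner algebras `eAe` -/

section Corner

variable {S A : Type*} [CommSemiring S] [Semiring A] [Algebra S A] {e : A}

/-- The `S`-algebra structure on the corner ring `eAe` of an `S`-algebra `A`: scalars act as on `A`,
and the unit is `e`. -/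
instance cornerAlgebra (he : IsIdempotentElem e) : Algebra S he.Corner where
  smul s c := ⟨s • c.1, by
    obtain ⟨_, a, rfl⟩ := c
    exact ⟨s • a, by simp⟩⟩
  algebraMap :=
    { toFun := fun s => ⟨s • e, s • 1, by simp [he.eq]⟩
      map_one' := Subtype.ext (one_smul S e)
      map_mul' := fun s t => Subtype.ext (by
        change (s * t) • e = (s • e) * (t • e)
        rw [smul_mul_smul_comm, he.eq])
      map_zero' := Subtype.ext (zero_smul S e)
      map_add' := fun s t => Subtype.ext (add_smul s t e) }
  commutes' s c := Subtype.ext (by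
    have h := (Subsemigroup.mem_corner_iff he).mp c.2
    change (s • e) * c.1 = c.1 * (s • e)
    rw [smul_mul_assoc, mul_smul_comm, h.1, h.2])
  smul_def' s c := Subtype.ext (by
    have h := (Subsemigroup.mem_corner_iff he).mp c.2
    change s • c.1 = (s • e) * c.1
    rw [smul_mul_assoc, h.1])

/-- The map `A → eAe`, `a ↦ eae`. -/
def toCorner (he : IsIdempotentElem e) (a : A) : he.Corner := ⟨e * a * e, a, rfl⟩

end Corner

/-! ### The algebra `A^τ` -/

/-- The ring of noncommuting polynomials `R⟨x, y⟩` over `R = ℂ[u]`. -/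
abbrev FreeXY : Type := FreeAlgebra ℂ[X] (Fin 2)

/-- The generator `x`. -/
def genX : FreeXY := FreeAlgebra.ι ℂ[X] 0

/-- The generator `y`. -/
def genY : FreeXY := FreeAlgebra.ι ℂ[X] 1

/-- The substitution of `R⟨x, y⟩` given by a matrix `g ∈ SL(2, ℂ)`: it is `R`-linear and sends
`x` to `g₀₀ x + g₁₀ y` and `y` to `g₀₁ x + g₁₁ y`, that is, `g` acts on the span of `x, y` as on the
standard basis of its natural two-dimensional representation. -/
def linSubst (g : SL(2, ℂ)) : FreeXY →ₐ[ℂ[X]] FreeXY :=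
  FreeAlgebra.lift ℂ[X] fun j =>
    ∑ i : Fin 2, Polynomial.C (g.1 i j) • FreeAlgebra.ι ℂ[X] i

theorem linSubst_ι (g : SL(2, ℂ)) (j : Fin 2) : linSubst g (FreeAlgebra.ι ℂ[X] j) =
    ∑ i : Fin 2, Polynomial.C (g.1 i j) • FreeAlgebra.ι ℂ[X] i := by
  simp [linSubst]

theorem linSubst_one : linSubst 1 = AlgHom.id ℂ[X] FreeXY := by
  apply FreeAlgebra.hom_ext
  funext j
  fin_cases j <;> simp [linSubst_ι]

theorem linSubst_mul (g h : SL(2, ℂ)) : linSubst (g * h) = (linSubst g).comp (linSubst h) := by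
  apply FreeAlgebra.hom_ext
  funext j
  simp only [Function.comp_apply, AlgHom.comp_apply, linSubst_ι, map_sum, map_smul]
  simp only [Fin.sum_univ_two, Matrix.SpecialLinearGroup.coe_mul, Matrix.mul_apply,
    Polynomial.C_add, Polynomial.C_mul]
  module

/-- The action of `SL(2, ℂ)` on `R⟨x, y⟩` by linear substitutions, trivial on `R`. Every subgroup
`G` acts by restriction. -/
instance substAction : MulSemiringAction SL(2, ℂ) FreeXY where
  smul g p := linSubst g p
  one_smul p := by change linSubst 1 p = p; rw [linSubst_one]; rfl
  mul_smul g h p := by change linSubst (g * h) p = linSubst g (linSubst h p); rw [linSubst_mul]; rfl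
  smul_zero g := map_zero (linSubst g)
  smul_add g := map_add (linSubst g)
  smul_one g := map_one (linSubst g)
  smul_mul g := map_mul (linSubst g)

instance substAction_smulComm : SMulCommClass SL(2, ℂ) ℂ[X] FreeXY where
  smul_comm g r p := map_smul (linSubst g) r p

variable (G : Subgroup SL(2, ℂ))

/-- The skew group algebra `R⟨x, y⟩ # G`, with multiplication `(p g)(q h) = (p · g(q)) (g h)`. -/
abbrev SkewAlg : Type := SkewMonoidAlgebra FreeXY G

/-- The inclusion of the group algebra `RG` into `R⟨x, y⟩ # G`. -/
def groupAlgToSkew : MonoidAlgebra ℂ[X] G →ₐ[ℂ[X]] SkewAlg G :=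
  MonoidAlgebra.lift ℂ[X] (SkewAlg G) G (SkewMonoidAlgebra.of FreeXY G)

/-- The elements of `R⟨x, y⟩`, as elements of `R⟨x, y⟩ # G`. -/
def coeffToSkew : FreeXY →+* SkewAlg G := SkewMonoidAlgebra.singleOneRingHom

variable {G}

/-- The single defining relation `xy = yx + τ` of `A^τ`. -/
inductive Rel (τ : MonoidAlgebra ℂ[X] G) : SkewAlg G → SkewAlg G → Prop
  | comm : Rel τ (coeffToSkew G (genX * genY))
      (coeffToSkew G (genY * genX) + groupAlgToSkew G τ)

/-- `A^τ = (R⟨x, y⟩ # G) / (xy - yx - τ)`: the quotient of the skew group algebra by the smallest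
ring congruence identifying `xy` with `yx + τ`, i.e. by the two-sided ideal generated by
`xy - yx - τ`. -/
abbrev AlgA (τ : MonoidAlgebra ℂ[X] G) : Type := RingQuot (Rel τ)

/-- The canonical map `RG → A^τ`. -/
def groupAlgToA (τ : MonoidAlgebra ℂ[X] G) : MonoidAlgebra ℂ[X] G →ₐ[ℂ[X]] AlgA τ :=
  (RingQuot.mkAlgHom ℂ[X] (Rel τ)).comp (groupAlgToSkew G)

section Average

variable (G) [Fintype G]

/-- The averaging element `|G|⁻¹ ∑ g` of the group algebra `RG`. -/
def average : MonoidAlgebra ℂ[X] G :=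
  Polynomial.C ((Fintype.card G : ℂ)⁻¹) • ∑ g : G, MonoidAlgebra.of ℂ[X] G g

theorem average_idem : IsIdempotentElem (average G) := by
  have h1 : ∀ g : G, MonoidAlgebra.of ℂ[X] G g * ∑ h : G, MonoidAlgebra.of ℂ[X] G h
      = ∑ h : G, MonoidAlgebra.of ℂ[X] G h := by
    intro g
    rw [Finset.mul_sum]
    simp_rw [← map_mul]
    exact Fintype.sum_equiv (Equiv.mulLeft g) _ _ (fun _ => rfl)
  have hc : (Fintype.card G : ℂ) ≠ 0 := by simp
  unfold IsIdempotentElem average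
  rw [smul_mul_smul_comm, Finset.sum_mul]
  simp_rw [h1]
  rw [Finset.sum_const, Finset.card_univ, ← Nat.cast_smul_eq_nsmul ℂ[X], smul_smul,
    ← Polynomial.C_eq_natCast, ← Polynomial.C_mul, ← Polynomial.C_mul]
  congr 2
  field_simp

end Average

variable [Fintype G]

/-- The averaging idempotent `e = |G|⁻¹ ∑ g`, as an element of `A^τ`. -/
def idem (τ : MonoidAlgebra ℂ[X] G) : AlgA τ := groupAlgToA τ (average G)

theorem idem_isIdempotent (τ : MonoidAlgebra ℂ[X] G) : IsIdempotentElem (idem τ) :=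
  (average_idem G).map (groupAlgToA τ)

/-- `C^τ = e A^τ e`, with unit `e`. -/
abbrev AlgC (τ : MonoidAlgebra ℂ[X] G) : Type := (idem_isIdempotent τ).Corner

/-- The map `φ : A^τ → C^τ`, `φ(a) = eae`. -/
def phi (τ : MonoidAlgebra ℂ[X] G) (a : AlgA τ) : AlgC τ := toCorner (idem_isIdempotent τ) a

/-! ### The identification of `R^I` with `Z(RG)` -/

section Components

variable {H : Type*} [Group H]

/-- The inclusion of the group algebra `ℂH` into `RH`. -/
def incl : MonoidAlgebra ℂ H →+* MonoidAlgebra ℂ[X] H :=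
  MonoidAlgebra.mapRingHom H Polynomial.C

/-- The coefficient of `u ^ n` of an element of `RH`. -/
def coefAt (n : ℕ) : MonoidAlgebra ℂ[X] H →+ MonoidAlgebra ℂ H where
  toFun a := MonoidAlgebra.map (Polynomial.lcoeff ℂ n).toAddMonoidHom a
  map_zero' := by ext; simp
  map_add' a b := by ext; simp

theorem coefAt_single (n : ℕ) (g : H) (p : ℂ[X]) :
    coefAt n (MonoidAlgebra.single g p) = MonoidAlgebra.single g (p.coeff n) := by
  simp [coefAt]

theorem incl_single (g : H) (c : ℂ) :
    incl (MonoidAlgebra.single g c) = MonoidAlgebra.single g (Polynomial.C c) := by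
  simp [incl]

theorem coefAt_smul_incl (n : ℕ) (p : ℂ[X]) (a : MonoidAlgebra ℂ H) :
    coefAt n (p • incl a) = p.coeff n • a := by
  induction a using MonoidAlgebra.induction_linear with
  | zero => simp
  | add a b ha hb => simp only [map_add, smul_add, ha, hb]
  | single g c => simp [incl_single, coefAt_single]

theorem coefAt_mul_incl (n : ℕ) (σ : MonoidAlgebra ℂ[X] H) (a : MonoidAlgebra ℂ H) :
    coefAt n (σ * incl a) = coefAt n σ * a := by
  induction σ using MonoidAlgebra.induction_linear with
  | zero => simp
  | add σ ρ h1 h2 => simp only [map_add, add_mul, h1, h2]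
  | single h p =>
    induction a using MonoidAlgebra.induction_linear with
    | zero => simp
    | add a b ha hb => simp only [map_add, mul_add, ha, hb]
    | single g c => simp [incl_single, coefAt_single, MonoidAlgebra.single_mul_single]

theorem coefAt_incl_mul (n : ℕ) (σ : MonoidAlgebra ℂ[X] H) (a : MonoidAlgebra ℂ H) :
    coefAt n (incl a * σ) = a * coefAt n σ := by
  induction σ using MonoidAlgebra.induction_linear with
  | zero => simp
  | add σ ρ h1 h2 => simp only [map_add, mul_add, h1, h2]
  | single h p =>
    induction a using MonoidAlgebra.induction_linear with
    | zero => simp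
    | add a b ha hb => simp only [map_add, add_mul, ha, hb]
    | single g c => simp [incl_single, coefAt_single, MonoidAlgebra.single_mul_single]

theorem coefAt_ext {σ ρ : MonoidAlgebra ℂ[X] H} (h : ∀ n, coefAt n σ = coefAt n ρ) : σ = ρ := by
  ext g n
  simpa [coefAt] using congrArg (fun a => a.coeff g) (h n)

theorem incl_mem_center {a : MonoidAlgebra ℂ H} (ha : ∀ b, b * a = a * b) :
    incl a ∈ Subalgebra.center ℂ[X] (MonoidAlgebra ℂ[X] H) := by
  rw [Subalgebra.mem_center_iff]
  intro σ
  apply coefAt_ext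
  intro n
  rw [coefAt_mul_incl, coefAt_incl_mul, ha]

variable {I : Type*} [Fintype I] [DecidableEq I] {δ : I → ℕ}

/-- Given a decomposition `Φ` of `ℂH` as a product of matrix algebras of sizes `δ i`, the central
idempotent of `ℂH` that corresponds to the `i`-th factor. -/
def blockIdem (Φ : MonoidAlgebra ℂ H ≃ₐ[ℂ] Π i, Matrix (Fin (δ i)) (Fin (δ i)) ℂ) (i : I) :
    MonoidAlgebra ℂ H :=
  Φ.symm (Pi.single i 1)

variable (Φ : MonoidAlgebra ℂ H ≃ₐ[ℂ] Π i, Matrix (Fin (δ i)) (Fin (δ i)) ℂ)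

theorem blockIdem_comm (i : I) (b : MonoidAlgebra ℂ H) :
    b * blockIdem Φ i = blockIdem Φ i * b := by
  apply Φ.injective
  simp only [map_mul, blockIdem, AlgEquiv.apply_symm_apply]
  funext j
  by_cases h : j = i
  · subst h; simp
  · simp [h]

/-- The central element `∑ i, (τ_i / δ_i) f_i` of `RH` with components `τ_i ∈ R`, where `f_i` is the
`i`-th central idempotent. -/
def ofComponents (t : I → ℂ[X]) : Subalgebra.center ℂ[X] (MonoidAlgebra ℂ[X] H) :=
  ⟨∑ i, (Polynomial.C ((δ i : ℂ)⁻¹) * t i) • incl (blockIdem Φ i),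
    Subalgebra.sum_mem _ fun i _ =>
      Subalgebra.smul_mem _ (incl_mem_center (blockIdem_comm Φ i)) _⟩

theorem Phi_coefAt_ofComponents (t : I → ℂ[X]) (n : ℕ) (j : I) :
    Φ (coefAt n (ofComponents Φ t).1) j = ((δ j : ℂ)⁻¹ * (t j).coeff n) • 1 := by
  simp only [ofComponents, map_sum, coefAt_smul_incl, map_smul, blockIdem,
    AlgEquiv.apply_symm_apply, Finset.sum_apply, Pi.smul_apply]
  rw [Finset.sum_eq_single j]
  · simp
  · intro i _ hij
    simp [Pi.single_eq_of_ne hij.symm]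
  · simp

theorem ofComponents_bijective (hδ : ∀ i, δ i ≠ 0) :
    Function.Bijective (ofComponents Φ) := by
  have hδ' : ∀ i, (δ i : ℂ) ≠ 0 := fun i => Nat.cast_ne_zero.mpr (hδ i)
  constructor
  · intro t s h
    funext j
    ext n
    have h1 := Phi_coefAt_ofComponents Φ t n j
    rw [h, Phi_coefAt_ofComponents Φ s n j] at h1
    have h2 := congrFun (congrFun h1 ⟨0, Nat.pos_of_ne_zero (hδ j)⟩)
      ⟨0, Nat.pos_of_ne_zero (hδ j)⟩
    simp at h2
    rcases h2 with h2 | h2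
    · exact h2.symm
    · exact absurd h2 (hδ j)
  · rintro ⟨σ, hσ⟩
    rw [Subalgebra.mem_center_iff] at hσ
    have hc : ∀ n j, ∃ c : ℂ, Φ (coefAt n σ) j = c • 1 := by
      intro n j
      have : Φ (coefAt n σ) j ∈ Set.range (Matrix.scalar (Fin (δ j))) := by
        apply Matrix.mem_range_scalar_of_commute_single
        intro p q _
        have h := hσ (incl (Φ.symm (Pi.single j (Matrix.single p q 1))))
        have h' := congrArg (fun a => Φ (coefAt n a) j) h
        simp only [coefAt_mul_incl, coefAt_incl_mul, map_mul, AlgEquiv.apply_symm_apply,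
          Pi.mul_apply, Pi.single_eq_same] at h'
        exact h'
      obtain ⟨c, hc⟩ := this
      refine ⟨c, ?_⟩
      rw [← hc]
      ext p q
      simp [Matrix.scalar_apply, Matrix.one_apply, Matrix.diagonal_apply]
    refine ⟨fun i => ∑ g ∈ σ.coeff.support,
      Polynomial.C ((Φ (MonoidAlgebra.single g 1) i).trace) * σ.coeff g, Subtype.ext ?_⟩
    apply coefAt_ext
    intro n
    apply Φ.injective
    funext j
    rw [Phi_coefAt_ofComponents]
    obtain ⟨c, hc⟩ := hc n j
    have key : coefAt n σ = ∑ g ∈ σ.coeff.support,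
        (σ.coeff g).coeff n • MonoidAlgebra.single g (1 : ℂ) := by
      conv_lhs => rw [← MonoidAlgebra.sum_coeff_single σ]
      rw [Finsupp.sum, map_sum]
      simp [coefAt_single]
    have htr : (Φ (coefAt n σ) j).trace = δ j * c := by
      rw [hc]; simp [Matrix.trace_smul, mul_comm]
    have hco : (∑ g ∈ σ.coeff.support, Polynomial.C ((Φ (MonoidAlgebra.single g 1) j).trace) *
        σ.coeff g).coeff n = (Φ (coefAt n σ) j).trace := by
      rw [key]
      simp only [Polynomial.finsetSum_coeff, Polynomial.coeff_C_mul, map_sum, map_smul,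
        Finset.sum_apply, Pi.smul_apply, Matrix.trace_sum, Matrix.trace_smul, smul_eq_mul]
      exact Finset.sum_congr rfl fun _ _ => mul_comm _ _
    rw [hco, htr, hc, inv_mul_cancel_left₀ (hδ' j)]

/-- The identification of `R^I` with `Z(RH)`, `(τ_i) ↦ ∑ i, (τ_i / δ_i) f_i`, attached to a
decomposition of `ℂH` as a product of nonzero matrix algebras. -/
def centerEquiv [hδ : ∀ i, NeZero (δ i)] :
    (I → ℂ[X]) ≃ Subalgebra.center ℂ[X] (MonoidAlgebra ℂ[X] H) :=
  Equiv.ofBijective (ofComponents Φ) (ofComponents_bijective Φ fun i => (hδ i).out)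

end Components

end CBH

end

open scoped Polynomial MatrixGroups

set_option linter.unusedSectionVars false

noncomputable section

namespace CBH

/-! ### The universal property of `A^τ` -/

section Universal

variable {G : Subgroup SL(2, ℂ)}

/-! Explicit deformations take the place of a PBW theorem. Given a faithful representation of
$R[x,y]\#G$ in an algebra `E`, keep the group constant and deform the commuting pair $w=(x,y)$ to
Laurent series $t^{-1}(w+v_1t+v_2t^2+\cdots)$ whose commutator is the image of $\tau$. Each order
asks for the solution of a linear equation, and averaging over $G\subset\mathrm{SL}_2$ makes the
solution equivariant (`exists_deformSeq`, `exists_laurent`). Ordered monomials $x^iy^jg$ span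
$A^\tau$, and the lowest Laurent coefficients keep their top-degree parts apart. So $A^\tau$ embeds
in Laurent series over `E` and is filtered by pole order, and its elements have symbols in
$R[x,y]\#G$ (`SymbolRep`).

Two algebras `E` are used. In $\mathrm{End}_R R[x,y]$ every element is a commutator with
multiplication by $y$, so every central $\tau$ is allowed. For functions on a generic $G$-orbit, `E`
is a matrix algebra over $\mathrm{Frac}\,R[x,y]$, and the equations are solvable for $G$-invariant
matrices of trace zero. This suffices when the coefficient of $1$ in $\tau$ vanishes, and $|G|$
times that coefficient is $\sum\delta_i\tau_i$. There $e$ becomes a matrix $J$ with all entries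
equal, every $JMJ$ is again constant, and constant matrices commute: hence $C^\tau$ is commutative.

For the centres, $\phi(z)=ze$ if $z$ is central. The ideal $AeA$ contains elements with symbols
$x^N$ and $y^N$, $N=|G|-1$, because nontrivial elements of $G$ have no eigenvalue $1$. Such elements
can be cancelled on the right, which gives injectivity. For $c$ central in $eAe$, consider
$\theta\colon peq\mapsto pcq$ on $AeA$. The identity $\theta(w)w'=w\theta(w')$ bounds its degree,
and coprimality of $x^N$ and $y^N$ lets one approximate $\theta$ by left multiplications, degree by
degree; since negative degrees are empty, this ends with $\theta(w)=zw$ exactly (`exists_eq_mul`).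
Left linearity of $\theta$ makes $z$ central, and $\theta(e)=c$ gives $ze=c$. -/

/-- The image in `A^τ` of a generator. -/
def genA (τ : MonoidAlgebra ℂ[X] G) (j : Fin 2) : AlgA τ :=
  RingQuot.mkAlgHom ℂ[X] (Rel τ) (coeffToSkew G (FreeAlgebra.ι ℂ[X] j))

/-- The image in `A^τ` of a group element. -/
def grpA (τ : MonoidAlgebra ℂ[X] G) : G →* AlgA τ :=
  (groupAlgToA τ : MonoidAlgebra ℂ[X] G →* AlgA τ).comp (MonoidAlgebra.of ℂ[X] G)

/-- A pair `v` in a `ℂ[X]`-algebra on which the group acts through `γ` as on the natural basis. -/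
def Equivariant {E : Type*} [Semiring E] [Algebra ℂ[X] E] (γ : G →* E) (v : Fin 2 → E) : Prop :=
  ∀ (g : G) (j : Fin 2), γ g * v j = (∑ i : Fin 2, Polynomial.C (g.1.1 i j) • v i) * γ g

theorem groupAlgToSkew_of (g : G) :
    groupAlgToSkew G (MonoidAlgebra.of ℂ[X] G g) = SkewMonoidAlgebra.of FreeXY G g := by
  simp [groupAlgToSkew]

theorem grpA_apply (τ : MonoidAlgebra ℂ[X] G) (g : G) :
    grpA τ g = RingQuot.mkAlgHom ℂ[X] (Rel τ) (SkewMonoidAlgebra.of FreeXY G g) := by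
  rw [← groupAlgToSkew_of]; rfl

theorem smul_freeXY (g : G) (p : FreeXY) : g • p = linSubst g.1 p := rfl

theorem coeffToSkew_smul (r : ℂ[X]) (p : FreeXY) :
    coeffToSkew G (r • p) = r • coeffToSkew G p :=
  (SkewMonoidAlgebra.smul_single r 1 p).symm

theorem of_mul_coeffToSkew (g : G) (p : FreeXY) :
    SkewMonoidAlgebra.of FreeXY G g * coeffToSkew G p =
      coeffToSkew G (g • p) * SkewMonoidAlgebra.of FreeXY G g := by
  change SkewMonoidAlgebra.single g 1 * SkewMonoidAlgebra.single 1 p =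
    SkewMonoidAlgebra.single 1 (g • p) * SkewMonoidAlgebra.single g 1
  rw [SkewMonoidAlgebra.single_mul_single, SkewMonoidAlgebra.single_mul_single, smul_one]
  simp

theorem equivariant_genA (τ : MonoidAlgebra ℂ[X] G) : Equivariant (grpA τ) (genA τ) := by
  intro g j
  have h := of_mul_coeffToSkew g (FreeAlgebra.ι ℂ[X] j)
  rw [smul_freeXY, linSubst_ι, map_sum] at h
  simp only [coeffToSkew_smul] at h
  have h2 := congrArg (RingQuot.mkAlgHom ℂ[X] (Rel τ)) h
  simp only [map_mul, map_sum, map_smul, ← grpA_apply] at h2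
  exact h2

theorem genA_relation (τ : MonoidAlgebra ℂ[X] G) :
    genA τ 0 * genA τ 1 = genA τ 1 * genA τ 0 + groupAlgToA τ τ := by
  have h := RingQuot.mkAlgHom_rel ℂ[X] (Rel.comm (τ := τ))
  rw [map_add, map_mul, map_mul, map_mul, map_mul] at h
  exact h

variable {E : Type*} [Semiring E] [Algebra ℂ[X] E]

/-- The homomorphism from the skew group algebra attached to an equivariant pair. -/
def skewLift (γ : G →* E) (v : Fin 2 → E) (hv : Equivariant γ v) : SkewAlg G →ₐ[ℂ[X]] E :=
  SkewMonoidAlgebra.liftNCAlgHom (FreeAlgebra.lift ℂ[X] v) γ (by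
    intro p g
    induction p using FreeAlgebra.induction with
    | grade0 r =>
      rw [smul_freeXY, AlgHom.commutes, AlgHom.commutes]
      exact Algebra.commutes _ _
    | grade1 j =>
      rw [smul_freeXY, linSubst_ι, map_sum]
      simp only [map_smul, FreeAlgebra.lift_ι_apply]
      exact (hv g j).symm
    | mul a b ha hb => rw [smul_mul', map_mul, map_mul, mul_assoc, hb, ← mul_assoc, ha, mul_assoc]
    | add a b ha hb => rw [smul_add, map_add, map_add, add_mul, mul_add, ha, hb])

theorem skewLift_coeff (γ : G →* E) (v : Fin 2 → E) (hv : Equivariant γ v) (p : FreeXY) :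
    skewLift γ v hv (coeffToSkew G p) = FreeAlgebra.lift ℂ[X] v p := by
  change SkewMonoidAlgebra.liftNC _ _ (SkewMonoidAlgebra.single 1 p) = _
  simp [SkewMonoidAlgebra.liftNC_single]

theorem skewLift_of (γ : G →* E) (v : Fin 2 → E) (hv : Equivariant γ v) (g : G) :
    skewLift γ v hv (SkewMonoidAlgebra.of FreeXY G g) = γ g := by
  change SkewMonoidAlgebra.liftNC _ _ (SkewMonoidAlgebra.single g 1) = _
  simp [SkewMonoidAlgebra.liftNC_single]

/-- The homomorphism from `A^τ` attached to an equivariant pair satisfying the relation. -/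
def liftA (τ : MonoidAlgebra ℂ[X] G) (γ : G →* E) (v : Fin 2 → E) (hv : Equivariant γ v)
    (hr : v 0 * v 1 = v 1 * v 0 + MonoidAlgebra.lift ℂ[X] E G γ τ) : AlgA τ →ₐ[ℂ[X]] E :=
  RingQuot.liftAlgHom ℂ[X] ⟨skewLift γ v hv, by
    rintro _ _ ⟨⟩
    have h : (skewLift γ v hv).comp (groupAlgToSkew G) = MonoidAlgebra.lift ℂ[X] E G γ := by
      refine MonoidAlgebra.algHom_ext (fun g => ?_) (Subsingleton.elim _ _)
      have := skewLift_of γ v hv g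
      rw [← groupAlgToSkew_of] at this
      simpa using this
    rw [map_add, ← AlgHom.comp_apply (skewLift γ v hv) (groupAlgToSkew G), h]
    simpa [skewLift_coeff, genX, genY] using hr⟩

theorem liftA_gen (τ : MonoidAlgebra ℂ[X] G) (γ : G →* E) (v : Fin 2 → E) (hv : Equivariant γ v)
    (hr : v 0 * v 1 = v 1 * v 0 + MonoidAlgebra.lift ℂ[X] E G γ τ) (j : Fin 2) :
    liftA τ γ v hv hr (genA τ j) = v j := by
  simp [liftA, genA, skewLift_coeff]

theorem liftA_grp (τ : MonoidAlgebra ℂ[X] G) (γ : G →* E) (v : Fin 2 → E) (hv : Equivariant γ v)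
    (hr : v 0 * v 1 = v 1 * v 0 + MonoidAlgebra.lift ℂ[X] E G γ τ) (g : G) :
    liftA τ γ v hv hr (grpA τ g) = γ g := by
  rw [grpA_apply]
  simp only [liftA, RingQuot.liftAlgHom_mkAlgHom_apply, skewLift_of]

end Universal

/-! ### The polynomial ring and its skew group algebra -/

/-- The commutative polynomial ring `R[x, y]`. -/
abbrev PolyXY : Type := MvPolynomial (Fin 2) ℂ[X]

/-- The linear substitution of `R[x, y]` given by a matrix. -/
def polySubst (g : SL(2, ℂ)) : PolyXY →ₐ[ℂ[X]] PolyXY :=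
  MvPolynomial.aeval fun j => ∑ i : Fin 2, Polynomial.C (g.1 i j) • MvPolynomial.X i

theorem polySubst_X (g : SL(2, ℂ)) (j : Fin 2) : polySubst g (MvPolynomial.X j) =
    ∑ i : Fin 2, Polynomial.C (g.1 i j) • MvPolynomial.X i := by
  simp [polySubst]

theorem polySubst_one : polySubst 1 = AlgHom.id ℂ[X] PolyXY := by
  apply MvPolynomial.algHom_ext
  intro j
  fin_cases j <;> simp [polySubst_X]

theorem polySubst_mul (g h : SL(2, ℂ)) : polySubst (g * h) = (polySubst g).comp (polySubst h) := by
  apply MvPolynomial.algHom_ext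
  intro j
  simp only [AlgHom.comp_apply, polySubst_X, map_sum, map_smul]
  simp only [Fin.sum_univ_two, Matrix.SpecialLinearGroup.coe_mul, Matrix.mul_apply,
    Polynomial.C_add, Polynomial.C_mul]
  module

/-- The action of `SL(2, ℂ)` on `R[x, y]` by linear substitutions. -/
instance polyAction : MulSemiringAction SL(2, ℂ) PolyXY where
  smul g p := polySubst g p
  one_smul p := by change polySubst 1 p = p; rw [polySubst_one]; rfl
  mul_smul g h p := by
    change polySubst (g * h) p = polySubst g (polySubst h p); rw [polySubst_mul]; rfl
  smul_zero g := map_zero (polySubst g)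
  smul_add g := map_add (polySubst g)
  smul_one g := map_one (polySubst g)
  smul_mul g := map_mul (polySubst g)

instance polyAction_smulComm : SMulCommClass SL(2, ℂ) ℂ[X] PolyXY where
  smul_comm g r p := map_smul (polySubst g) r p

theorem smul_polyXY {G : Subgroup SL(2, ℂ)} (g : G) (p : PolyXY) : g • p = polySubst g.1 p := rfl

/-- The skew group algebra `R[x, y] # G`. -/
abbrev PolySkew (G : Subgroup SL(2, ℂ)) : Type := SkewMonoidAlgebra PolyXY G

/-! ### Deforming a commuting equivariant pair -/

section Deformation

variable {G : Subgroup SL(2, ℂ)} {E : Type*} [Ring E] [Algebra ℂ[X] E]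

/-- The symplectic pairing of two pairs of elements of a ring. -/
def wedge (a b : Fin 2 → E) : E := a 0 * b 1 - a 1 * b 0

theorem wedge_smul_left (r : ℂ[X]) (a b : Fin 2 → E) : wedge (r • a) b = r • wedge a b := by
  simp [wedge, smul_sub]

theorem wedge_smul_right (r : ℂ[X]) (a b : Fin 2 → E) : wedge a (r • b) = r • wedge a b := by
  simp [wedge, smul_sub]

theorem wedge_sum_left {ι : Type*} (s : Finset ι) (a : ι → Fin 2 → E) (b : Fin 2 → E) :
    wedge (∑ i ∈ s, a i) b = ∑ i ∈ s, wedge (a i) b := by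
  simp [wedge, Finset.sum_mul, Finset.sum_apply]

theorem wedge_sum_right {ι : Type*} (s : Finset ι) (a : Fin 2 → E) (b : ι → Fin 2 → E) :
    wedge a (∑ i ∈ s, b i) = ∑ i ∈ s, wedge a (b i) := by
  simp [wedge, Finset.mul_sum, Finset.sum_apply]

theorem det_C (g : SL(2, ℂ)) :
    Polynomial.C (g.1 0 0) * Polynomial.C (g.1 1 1) -
      Polynomial.C (g.1 0 1) * Polynomial.C (g.1 1 0) = 1 := by
  rw [← Polynomial.C_mul, ← Polynomial.C_mul, ← Polynomial.C_sub, ← Matrix.det_fin_two, g.2,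
    Polynomial.C_1]

/-- The linear substitution by `g` of a pair of elements. -/
def matAct (g : SL(2, ℂ)) (a : Fin 2 → E) (j : Fin 2) : E :=
  ∑ i : Fin 2, Polynomial.C (g.1 i j) • a i

/-- A substitution multiplies the pairing by its determinant, which is $1$. Scalars are central, so
`E` need not be commutative. -/
theorem wedge_matAct (g : SL(2, ℂ)) (a b : Fin 2 → E) :
    wedge (matAct g a) (matAct g b) = wedge a b := by
  simp only [wedge, matAct, Fin.sum_univ_two, add_mul, mul_add, smul_mul_smul_comm]
  trans (Polynomial.C (g.1 0 0) * Polynomial.C (g.1 1 1) -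
      Polynomial.C (g.1 0 1) * Polynomial.C (g.1 1 0)) • (a 0 * b 1 - a 1 * b 0)
  · module
  · rw [det_C, one_smul]

theorem matAct_mul (g h : SL(2, ℂ)) (a : Fin 2 → E) :
    matAct (g * h) a = matAct h (matAct g a) := by
  funext j
  simp only [matAct, Fin.sum_univ_two, Matrix.SpecialLinearGroup.coe_mul, Matrix.mul_apply,
    Polynomial.C_add, Polynomial.C_mul]
  module

theorem matAct_one (a : Fin 2 → E) : matAct 1 a = a := by
  funext j
  fin_cases j <;> simp [matAct]

variable (γ : G →* E)

/-- Conjugation by a group element on pairs. -/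
def conjPair (g : G) (a : Fin 2 → E) : Fin 2 → E := fun j => γ g * a j * γ g⁻¹

theorem gamma_mul_inv (g : G) : γ g * γ g⁻¹ = 1 := by rw [← map_mul, mul_inv_cancel, map_one]

theorem gamma_inv_mul (g : G) : γ g⁻¹ * γ g = 1 := by rw [← map_mul, inv_mul_cancel, map_one]

theorem equivariant_iff_conjPair {a : Fin 2 → E} :
    Equivariant γ a ↔ ∀ g : G, conjPair γ g a = matAct g.1 a := by
  constructor
  · intro h g
    funext j
    rw [conjPair, h g j, mul_assoc, gamma_mul_inv, mul_one]
    rfl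
  · intro h g j
    have := congrFun (h g) j
    rw [conjPair] at this
    calc γ g * a j = γ g * a j * γ g⁻¹ * γ g := by rw [mul_assoc, gamma_inv_mul, mul_one]
      _ = _ := by rw [this]; rfl

theorem wedge_conjPair (g : G) (a b : Fin 2 → E) :
    wedge (conjPair γ g a) (conjPair γ g b) = γ g * wedge a b * γ g⁻¹ := by
  have h : ∀ s t : E, γ g * s * γ g⁻¹ * (γ g * t * γ g⁻¹) = γ g * (s * t) * γ g⁻¹ := by
    intro s t
    calc _ = γ g * s * (γ g⁻¹ * γ g) * t * γ g⁻¹ := by noncomm_ring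
      _ = _ := by rw [gamma_inv_mul]; noncomm_ring
  simp only [wedge, conjPair, h]
  noncomm_ring

theorem conjPair_mul (g h : G) (a : Fin 2 → E) :
    conjPair γ (g * h) a = conjPair γ g (conjPair γ h a) := by
  funext j
  simp only [conjPair, mul_inv_rev, map_mul, mul_assoc]

theorem conjPair_matAct (g : G) (h : SL(2, ℂ)) (a : Fin 2 → E) :
    conjPair γ g (matAct h a) = matAct h (conjPair γ g a) := by
  funext j
  simp [conjPair, matAct, mul_add, add_mul]

/-- Conjugation by $g$ acts on both pairs as the substitution by $g$, which the pairing ignores.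
Hence the errors in the deformation are $G$-invariant. -/
theorem wedge_commute {a b : Fin 2 → E} (ha : Equivariant γ a) (hb : Equivariant γ b) (g : G) :
    γ g * wedge a b = wedge a b * γ g := by
  rw [equivariant_iff_conjPair] at ha hb
  have h := wedge_conjPair γ g a b
  rw [ha, hb, wedge_matAct] at h
  calc γ g * wedge a b = γ g * wedge a b * (γ g⁻¹ * γ g) := by rw [gamma_inv_mul, mul_one]
    _ = wedge a b * γ g := by rw [← mul_assoc, ← h]

variable [Fintype G]

/-- The average of a pair over the group. -/
def avgPair (a : Fin 2 → E) : Fin 2 → E :=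
  (Polynomial.C ((Fintype.card G : ℂ)⁻¹) : ℂ[X]) •
    ∑ g : G, matAct (g.1⁻¹) (conjPair γ g a)

theorem card_C_smul {M : Type*} [AddCommGroup M] [Module ℂ[X] M] (m : M) :
    (Polynomial.C ((Fintype.card G : ℂ)⁻¹) : ℂ[X]) • (Fintype.card G • m) = m := by
  have hc : (Fintype.card G : ℂ) ≠ 0 := by simp
  rw [← Nat.cast_smul_eq_nsmul ℂ[X], smul_smul, ← Polynomial.C_eq_natCast, ← Polynomial.C_mul,
    inv_mul_cancel₀ hc, Polynomial.C_1, one_smul]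

theorem matAct_add (g : SL(2, ℂ)) (a b : Fin 2 → E) :
    matAct g (a + b) = matAct g a + matAct g b := by
  funext j; simp only [matAct, Fin.sum_univ_two, Pi.add_apply]; module

theorem matAct_sum {ι : Type*} (g : SL(2, ℂ)) (s : Finset ι) (a : ι → Fin 2 → E) :
    matAct g (∑ i ∈ s, a i) = ∑ i ∈ s, matAct g (a i) := by
  classical
  induction s using Finset.induction_on with
  | empty => funext j; simp [matAct]
  | insert i s hi ih => rw [Finset.sum_insert hi, Finset.sum_insert hi, matAct_add, ih]

theorem matAct_smul (g : SL(2, ℂ)) (r : ℂ[X]) (a : Fin 2 → E) :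
    matAct g (r • a) = r • matAct g a := by
  funext j; simp only [matAct, Fin.sum_univ_two, Pi.smul_apply]; module

theorem conjPair_smul (g : G) (r : ℂ[X]) (a : Fin 2 → E) :
    conjPair γ g (r • a) = r • conjPair γ g a := by
  funext j; simp [conjPair]

theorem conjPair_sum {ι : Type*} (g : G) (s : Finset ι) (a : ι → Fin 2 → E) :
    conjPair γ g (∑ i ∈ s, a i) = ∑ i ∈ s, conjPair γ g (a i) := by
  funext j; simp [conjPair, Finset.mul_sum, Finset.sum_mul, Finset.sum_apply]

theorem equivariant_avgPair (a : Fin 2 → E) : Equivariant γ (avgPair γ a) := by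
  rw [equivariant_iff_conjPair]
  intro h
  rw [avgPair, conjPair_smul, conjPair_sum, matAct_smul, matAct_sum]
  congr 1
  refine Fintype.sum_equiv (Equiv.mulLeft h) _ _ fun g => ?_
  rw [conjPair_matAct, ← conjPair_mul, ← matAct_mul]
  simp

/-- Conjugating by $g$ and substituting by $g^{-1}$ fixes both `w` and `e`, so each summand of the
average solves the equation; a mean of solutions of an affine equation is a solution. -/
theorem avgPair_solves {w a : Fin 2 → E} {e : E} (hw : Equivariant γ w)
    (he : ∀ g, γ g * e = e * γ g) (h : wedge w a + wedge a w = e) :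
    wedge w (avgPair γ a) + wedge (avgPair γ a) w = e := by
  have key : ∀ g : G, wedge w (matAct (g.1⁻¹) (conjPair γ g a)) +
      wedge (matAct (g.1⁻¹) (conjPair γ g a)) w = e := by
    intro g
    have hwg : w = matAct (g.1⁻¹) (conjPair γ g w) := by
      rw [(equivariant_iff_conjPair γ).1 hw g, ← matAct_mul, mul_inv_cancel, matAct_one]
    rw [hwg, wedge_matAct, wedge_matAct, wedge_conjPair, wedge_conjPair, ← add_mul,
      ← mul_add, h, he, mul_assoc, gamma_mul_inv, mul_one]
  rw [avgPair, wedge_smul_left, wedge_smul_right, ← smul_add, wedge_sum_left, wedge_sum_right,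
    ← Finset.sum_add_distrib, Finset.sum_congr rfl fun g _ => key g, Finset.sum_const,
    Finset.card_univ, card_C_smul]

/-- The coefficients of a formal deformation of the pair `w`, given a way `sol` of correcting the
error of each order. -/
def deformSeq (sol : E → Fin 2 → E) (w : Fin 2 → E) (T : E) : ℕ → Fin 2 → E
  | 0 => w
  -- The omitted end terms pair the new coefficient with `w`. The target `T` sits in order $2$
  -- because each generator will carry a factor $t^{-1}$.
  | n + 1 => sol ((if n + 1 = 2 then T else 0) -
      ∑ i : Fin n, wedge (deformSeq sol w T (i.1 + 1)) (deformSeq sol w T (n - i.1)))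
  decreasing_by all_goals omega

/-- `P` is a space of right-hand sides for which the linearised equation is solvable on
$G$-invariants. Since it contains all commutators and `T`, no error ever leaves it, and the
recursion meets no obstruction. -/
theorem exists_deformSeq (w : Fin 2 → E) (hw : Equivariant γ w) (hc : w 0 * w 1 = w 1 * w 0)
    (P : Submodule ℂ[X] E) (hP : ∀ a b : E, a * b - b * a ∈ P) {T : E} (hT : T ∈ P)
    (hTG : ∀ g, γ g * T = T * γ g)
    (hsolve : ∀ e ∈ P, (∀ g, γ g * e = e * γ g) → ∃ a : Fin 2 → E, wedge w a + wedge a w = e) :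
    ∃ v : ℕ → Fin 2 → E, v 0 = w ∧ (∀ n, Equivariant γ (v n)) ∧
      ∀ n, ∑ p ∈ Finset.HasAntidiagonal.antidiagonal n, wedge (v p.1) (v p.2) = if n = 2 then T else 0 := by
  have hsol : ∀ e : E, ∃ a : Fin 2 → E, (e ∈ P ∧ ∀ g, γ g * e = e * γ g) →
      Equivariant γ a ∧ wedge w a + wedge a w = e := by
    intro e
    by_cases h : e ∈ P ∧ ∀ g, γ g * e = e * γ g
    · obtain ⟨a, ha⟩ := hsolve e h.1 h.2
      exact ⟨avgPair γ a, fun _ => ⟨equivariant_avgPair γ a, avgPair_solves γ hw h.2 ha⟩⟩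
    · exact ⟨0, fun h' => absurd h' h⟩
  choose sol hsol using hsol
  set v := deformSeq sol w T with hv
  have v0 : v 0 = w := by rw [hv, deformSeq]
  have vs : ∀ n, v (n + 1) = sol ((if n + 1 = 2 then T else 0) -
      ∑ i ∈ Finset.range n, wedge (v (i + 1)) (v (n - i))) := by
    intro n
    rw [hv, deformSeq, Finset.sum_range]
  have errP : ∀ n, (if n + 1 = 2 then T else 0) -
      ∑ i ∈ Finset.range n, wedge (v (i + 1)) (v (n - i)) ∈ P := by
    intro n
    refine P.sub_mem (by split_ifs <;> simp [hT]) ?_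
    -- Reversing the order of summation in the second half of the pairings turns the sum into a sum
    -- of genuine commutators.
    have h : ∑ i ∈ Finset.range n, wedge (v (i + 1)) (v (n - i)) =
        ∑ i ∈ Finset.range n, (v (i + 1) 0 * v (n - i) 1 - v (n - i) 1 * v (i + 1) 0) := by
      simp only [wedge, Finset.sum_sub_distrib]
      congr 1
      rw [← Finset.sum_range_reflect]
      refine Finset.sum_congr rfl fun i hi => ?_
      have hi := Finset.mem_range.1 hi
      rw [show n - 1 - i + 1 = n - i by omega, show n - (n - 1 - i) = i + 1 by omega]
    rw [h]
    exact P.sum_mem fun i _ => hP _ _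
  have heq : ∀ n, Equivariant γ (v n) := by
    intro n
    induction n using Nat.strong_induction_on with
    | _ n ih =>
      rcases n with _ | n
      · rwa [v0]
      · rw [vs]
        refine (hsol _ ⟨errP n, fun g => ?_⟩).1
        rw [mul_sub, sub_mul, Finset.mul_sum, Finset.sum_mul]
        congr 1
        · split_ifs <;> simp [hTG]
        · refine Finset.sum_congr rfl fun i hi => ?_
          have hi := Finset.mem_range.1 hi
          exact wedge_commute γ (ih _ (by omega)) (ih _ (by omega)) g
  refine ⟨v, v0, heq, fun n => ?_⟩
  rw [Finset.Nat.sum_antidiagonal_eq_sum_range_succ (fun i j => wedge (v i) (v j))]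
  rcases n with _ | n
  · simp [v0, wedge, hc]
  · have h2 := (hsol _ ⟨errP n, fun g => by
      rw [mul_sub, sub_mul, Finset.mul_sum, Finset.sum_mul]
      congr 1
      · split_ifs <;> simp [hTG]
      · exact Finset.sum_congr rfl fun i _ => wedge_commute γ (heq _) (heq _) g⟩).2
    rw [← vs] at h2
    rw [Finset.sum_range_succ, Finset.sum_range_succ', Nat.sub_zero, Nat.sub_self, v0,
      Finset.sum_congr rfl (fun i _ => by rw [Nat.add_sub_add_right])]
    rw [add_assoc, h2, add_sub_cancel]

end Deformation

/-! ### Representations of `A^τ` over Laurent series -/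

section Laurent

variable {G : Subgroup SL(2, ℂ)} {E : Type*} [Ring E] [Algebra ℂ[X] E]

open HahnSeries in
theorem commute_of_coeff {a b : HahnSeries ℤ E}
    (h : ∀ i j, a.coeff i * b.coeff j = b.coeff j * a.coeff i) : a * b = b * a := by
  ext n
  rw [coeff_mul, coeff_mul]
  refine Finset.sum_bij' (fun p _ => (p.2, p.1)) (fun p _ => (p.2, p.1)) ?_ ?_ ?_ ?_ ?_
  · intro p hp
    rw [Finset.mem_antidiagonal] at hp ⊢
    exact ⟨hp.2.1, hp.1, by rw [add_comm]; exact hp.2.2⟩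
  · intro p hp
    rw [Finset.mem_antidiagonal] at hp ⊢
    exact ⟨hp.2.1, hp.1, by rw [add_comm]; exact hp.2.2⟩
  · intro p _; rfl
  · intro p _; rfl
  · intro p _; exact h _ _

theorem single_one_comm (n : ℤ) (a : HahnSeries ℤ E) :
    HahnSeries.single n 1 * a = a * HahnSeries.single n 1 := by
  apply commute_of_coeff
  intro i j
  rw [HahnSeries.coeff_single]
  split_ifs <;> simp

theorem lift_C_comp (γ : G →* E) (σ : MonoidAlgebra ℂ[X] G) :
    MonoidAlgebra.lift ℂ[X] (HahnSeries ℤ E) G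
      ((HahnSeries.C : E →+* HahnSeries ℤ E).toMonoidHom.comp γ) σ =
      HahnSeries.C (MonoidAlgebra.lift ℂ[X] E G γ σ) := by
  induction σ using MonoidAlgebra.induction_linear with
  | zero => simp
  | add a b ha hb => rw [map_add, ha, hb, map_add, map_add]
  | single g r =>
    rw [MonoidAlgebra.lift_single, MonoidAlgebra.lift_single]
    ext n
    by_cases hn : n = 0 <;> simp [HahnSeries.coeff_smul, HahnSeries.C_apply, hn]

/-- The generators go to $t^{-1}\sum v_nt^n$. The relation of order $n$ then lives at $t^{n-2}$, so
the single nonzero one, of order $2$, produces the constant series `T`. -/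
theorem exists_laurent (τ : MonoidAlgebra ℂ[X] G) (γ : G →* E) (v : ℕ → Fin 2 → E)
    (hv : ∀ n, Equivariant γ (v n))
    (hr : ∀ n, ∑ p ∈ Finset.HasAntidiagonal.antidiagonal n, wedge (v p.1) (v p.2) =
      if n = 2 then MonoidAlgebra.lift ℂ[X] E G γ τ else 0) :
    ∃ ρ : AlgA τ →ₐ[ℂ[X]] HahnSeries ℤ E, (∀ g, ρ (grpA τ g) = HahnSeries.C (γ g)) ∧
      ∀ j, (∀ n < -1, (ρ (genA τ j)).coeff n = 0) ∧ (ρ (genA τ j)).coeff (-1) = v 0 j := by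
  set T := MonoidAlgebra.lift ℂ[X] E G γ τ with hT
  set p : Fin 2 → PowerSeries E := fun j => PowerSeries.mk fun n => v n j with hp
  set q : Fin 2 → HahnSeries ℤ E := fun j =>
    HahnSeries.single (-1) 1 * HahnSeries.ofPowerSeries ℤ E (p j) with hq
  have hcoeff : ∀ j (n : ℤ), (q j).coeff n = (HahnSeries.ofPowerSeries ℤ E (p j)).coeff (n + 1) := by
    intro j n
    have := HahnSeries.coeff_single_mul_add (r := (1 : E)) (x := HahnSeries.ofPowerSeries ℤ E (p j))
      (a := n + 1) (b := -1)
    simpa using this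
  have hC : ∀ (g : G) (j : Fin 2), PowerSeries.C (γ g) * p j =
      (∑ i : Fin 2, Polynomial.C (g.1.1 i j) • p i) * PowerSeries.C (γ g) := by
    intro g j
    ext n
    simpa [hp] using hv n g j
  have hqe : Equivariant ((HahnSeries.C : E →+* HahnSeries ℤ E).toMonoidHom.comp γ) q := by
    intro g j
    have h := congrArg (HahnSeries.ofPowerSeries ℤ E) (hC g j)
    have hs : ∀ (r : ℂ[X]) (f : PowerSeries E), HahnSeries.ofPowerSeries ℤ E (r • f) =
        r • HahnSeries.ofPowerSeries ℤ E f := by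
      intro r f
      exact map_smul (HahnSeries.ofPowerSeriesAlg ℤ ℂ[X] (A := E)) r f
    rw [map_mul, map_mul, map_sum, HahnSeries.ofPowerSeries_C] at h
    simp only [hs] at h
    change HahnSeries.C (γ g) * (HahnSeries.single (-1) 1 * _) = _ * HahnSeries.C (γ g)
    rw [← mul_assoc, ← single_one_comm, mul_assoc, h, ← mul_assoc, Finset.mul_sum]
    simp only [mul_smul_comm, hq]
  have hqr : q 0 * q 1 = q 1 * q 0 + MonoidAlgebra.lift ℂ[X] (HahnSeries ℤ E) G
      ((HahnSeries.C : E →+* HahnSeries ℤ E).toMonoidHom.comp γ) τ := by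
    have h1 : p 0 * p 1 = p 1 * p 0 + PowerSeries.C T * PowerSeries.X ^ 2 := by
      ext n
      rw [map_add, PowerSeries.coeff_mul, PowerSeries.coeff_mul, PowerSeries.coeff_C_mul,
        PowerSeries.coeff_X_pow, ← sub_eq_iff_eq_add', ← Finset.sum_sub_distrib]
      have := hr n
      simp only [wedge] at this
      simp only [hp, PowerSeries.coeff_mk, this]
      split_ifs <;> simp
    have h2 : ∀ i j, q i * q j = HahnSeries.single (-2) 1 *
        HahnSeries.ofPowerSeries ℤ E (p i * p j) := by
      intro i j
      simp only [hq]
      rw [map_mul, mul_assoc, ← mul_assoc _ (HahnSeries.single (-1) 1), ← single_one_comm,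
        mul_assoc (HahnSeries.single (-1) 1) _ (HahnSeries.ofPowerSeries ℤ E (p j)), ← mul_assoc,
        HahnSeries.single_mul_single]
      norm_num
    rw [h2, h2, h1, map_add, mul_add, lift_C_comp, map_mul _ (PowerSeries.C T),
      HahnSeries.ofPowerSeries_C,
      HahnSeries.ofPowerSeries_X_pow, ← mul_assoc (HahnSeries.single (-2) 1) (HahnSeries.C T),
      single_one_comm (-2) (HahnSeries.C T), mul_assoc,
      HahnSeries.single_mul_single]
    simp [← hT]
  refine ⟨liftA τ _ q hqe hqr, fun g => liftA_grp τ _ q hqe hqr g, fun j => ?_⟩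
  rw [liftA_gen]
  refine ⟨fun n hn => ?_, ?_⟩
  · rw [hcoeff, HahnSeries.ofPowerSeries_apply]
    apply HahnSeries.embDomain_of_notMem_range
    rintro ⟨m, hm⟩
    have : ((m : ℕ) : ℤ) = n + 1 := hm
    omega
  · rw [hcoeff]
    have := HahnSeries.ofPowerSeries_apply_coeff (Γ := ℤ) (p j) 0
    simpa [hp] using this

end Laurent

/-! ### Ordered monomials span `A^τ` -/

/-- The ring structure of `A^τ`. -/
abbrev algARing {G : Subgroup SL(2, ℂ)} (τ : MonoidAlgebra ℂ[X] G) : Ring (AlgA τ) :=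
  letI : Neg (AlgA τ) := ⟨fun a => (-1 : ℂ[X]) • a⟩
  { (inferInstance : Semiring (AlgA τ)) with
    neg := fun a => (-1 : ℂ[X]) • a
    zsmul := zsmulRec
    neg_add_cancel := fun a => by
      have : (-1 : ℂ[X]) • a + (1 : ℂ[X]) • a = 0 := by rw [← add_smul]; simp
      rwa [one_smul] at this }

section FilteredRing

attribute [local instance] algARing

section Spanning

variable {G : Subgroup SL(2, ℂ)} (τ : MonoidAlgebra ℂ[X] G)

/-- The span of the ordered monomials of degree less than `k`. -/
def ordSpan (k : ℕ) : Submodule ℂ[X] (AlgA τ) :=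
  Submodule.span ℂ[X]
    {a | ∃ (i j : ℕ) (g : G), i + j < k ∧ a = genA τ 0 ^ i * genA τ 1 ^ j * grpA τ g}

variable {τ}

theorem ordSpan_mono {k l : ℕ} (h : k ≤ l) : ordSpan τ k ≤ ordSpan τ l :=
  Submodule.span_mono fun _ ⟨i, j, g, hk, ha⟩ => ⟨i, j, g, hk.trans_le h, ha⟩

theorem mem_ordSpan (i j : ℕ) (g : G) {k : ℕ} (h : i + j < k) :
    genA τ 0 ^ i * genA τ 1 ^ j * grpA τ g ∈ ordSpan τ k :=
  Submodule.subset_span ⟨i, j, g, h, rfl⟩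

theorem ordSpan_mul_le {k l : ℕ} (c : AlgA τ)
    (h : ∀ (i j : ℕ) (g : G), i + j < k →
      c * (genA τ 0 ^ i * genA τ 1 ^ j * grpA τ g) ∈ ordSpan τ l) {a : AlgA τ}
    (ha : a ∈ ordSpan τ k) : c * a ∈ ordSpan τ l := by
  induction ha using Submodule.span_induction with
  | mem a ha => obtain ⟨i, j, g, hk, rfl⟩ := ha; exact h i j g hk
  | zero => simp
  | add a b _ _ ha hb => rw [mul_add]; exact add_mem ha hb
  | smul r a _ ha => rw [mul_smul_comm]; exact Submodule.smul_mem _ _ ha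

theorem genX_mul_mem {k : ℕ} {a : AlgA τ} (ha : a ∈ ordSpan τ k) :
    genA τ 0 * a ∈ ordSpan τ (k + 1) := by
  refine ordSpan_mul_le _ (fun i j g h => ?_) ha
  rw [← mul_assoc, ← mul_assoc, ← pow_succ']
  exact mem_ordSpan _ _ _ (by omega)

theorem groupAlgToA_mul_mem {k : ℕ} (hk : ∀ (g : G), ∀ a ∈ ordSpan τ k, grpA τ g * a ∈ ordSpan τ k)
    (σ : MonoidAlgebra ℂ[X] G) {a : AlgA τ} (ha : a ∈ ordSpan τ k) :
    groupAlgToA τ σ * a ∈ ordSpan τ k := by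
  induction σ using MonoidAlgebra.induction_linear with
  | zero => simp
  | add σ σ' h h' => rw [map_add, add_mul]; exact add_mem h h'
  | single g r =>
    have : MonoidAlgebra.single g r = r • MonoidAlgebra.of ℂ[X] G g := by simp
    rw [this, map_smul, smul_mul_assoc]
    exact Submodule.smul_mem _ _ (hk g a ha)

/-- The two claims need each other: moving $g$ past a generator creates $y$, while moving $y$ past
$x$ creates $-\tau$, a combination of group elements in lower degree. -/
theorem grp_gen_mul_mem (k : ℕ) :
    (∀ (g : G), ∀ a ∈ ordSpan τ k, grpA τ g * a ∈ ordSpan τ k) ∧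
      ∀ a ∈ ordSpan τ k, genA τ 1 * a ∈ ordSpan τ (k + 1) := by
  induction k with
  | zero =>
    have h : ∀ a ∈ ordSpan τ 0, a = 0 := by
      intro a ha
      have : ordSpan τ 0 = ⊥ := by
        rw [ordSpan, Submodule.span_eq_bot]
        rintro _ ⟨i, j, g, h, _⟩
        omega
      rwa [this, Submodule.mem_bot] at ha
    exact ⟨fun g a ha => by rw [h a ha]; simp, fun a ha => by rw [h a ha]; simp⟩
  | succ k ih =>
    have hgen : ∀ (g : G) (j : Fin 2), ∀ a ∈ ordSpan τ k,
        grpA τ g * (genA τ j * a) ∈ ordSpan τ (k + 1) := by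
      intro g j a ha
      rw [← mul_assoc, equivariant_genA τ g j, mul_assoc, Fin.sum_univ_two, add_mul,
        smul_mul_assoc, smul_mul_assoc]
      exact add_mem (Submodule.smul_mem _ _ (genX_mul_mem (ih.1 g a ha)))
        (Submodule.smul_mem _ _ (ih.2 _ (ih.1 g a ha)))
    constructor
    · intro g a ha
      refine ordSpan_mul_le _ (fun i j h hij => ?_) ha
      rcases i with _ | i
      · rcases j with _ | j
        · rw [pow_zero, pow_zero, one_mul, one_mul, ← map_mul]
          simpa using mem_ordSpan (τ := τ) 0 0 (g * h) (k := k + 1) (by omega)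
        · rw [pow_zero, one_mul, pow_succ', mul_assoc]
          refine hgen _ _ _ ?_
          simpa using mem_ordSpan (τ := τ) 0 j h (k := k) (by omega)
      · rw [pow_succ', mul_assoc, mul_assoc]
        refine hgen _ _ _ ?_
        rw [← mul_assoc]
        exact mem_ordSpan i j h (by omega)
    · intro a ha
      refine ordSpan_mul_le _ (fun i j h hij => ?_) ha
      rcases i with _ | i
      · rw [pow_zero, one_mul, ← mul_assoc, ← pow_succ']
        simpa using mem_ordSpan (τ := τ) 0 (j + 1) h (k := k + 1 + 1) (by omega)
      · have hb := mem_ordSpan (τ := τ) i j h (k := k) (by omega)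
        have hr : genA τ 1 * genA τ 0 = genA τ 0 * genA τ 1 - groupAlgToA τ τ := by
          rw [genA_relation, add_sub_cancel_right]
        rw [pow_succ', mul_assoc, mul_assoc, ← mul_assoc (genA τ 1), hr, sub_mul, mul_assoc,
          ← mul_assoc (genA τ 0 ^ i)]
        exact sub_mem (genX_mul_mem (ih.2 _ hb))
          (ordSpan_mono (by omega) (groupAlgToA_mul_mem ih.1 τ hb))

/-- The union of the spans is stable under left multiplication by polynomials in the generators, and
the skew group algebra is spanned by products of such polynomials with group elements. -/
theorem exists_mem_ordSpan (a : AlgA τ) : ∃ k, a ∈ ordSpan τ k := by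
  set U : Submodule ℂ[X] (AlgA τ) := ⨆ k, ordSpan τ k with hU
  have hmem : ∀ a, a ∈ U ↔ ∃ k, a ∈ ordSpan τ k := fun a =>
    Submodule.mem_iSup_of_directed _ (fun k l =>
      ⟨max k l, ordSpan_mono (le_max_left _ _), ordSpan_mono (le_max_right _ _)⟩)
  have hfree : ∀ p : FreeXY, ∀ a ∈ U,
      RingQuot.mkAlgHom ℂ[X] (Rel τ) (coeffToSkew G p) * a ∈ U := by
    intro p
    induction p using FreeAlgebra.induction with
    | grade0 r =>
      intro a ha
      have : coeffToSkew G (algebraMap ℂ[X] FreeXY r) = r • 1 := by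
        rw [Algebra.algebraMap_eq_smul_one, coeffToSkew_smul, map_one]
      rw [this, map_smul, map_one, smul_mul_assoc, one_mul]
      exact U.smul_mem _ ha
    | grade1 j =>
      intro a ha
      obtain ⟨k, hk⟩ := (hmem a).1 ha
      refine (hmem _).2 ⟨k + 1, ?_⟩
      fin_cases j
      · exact genX_mul_mem hk
      · exact (grp_gen_mul_mem k).2 a hk
    | mul p q hp hq =>
      intro a ha
      rw [map_mul, map_mul, mul_assoc]
      exact hp _ (hq a ha)
    | add p q hp hq =>
      intro a ha
      rw [map_add, map_add, add_mul]
      exact add_mem (hp a ha) (hq a ha)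
  rw [← hmem]
  obtain ⟨b, rfl⟩ := RingQuot.mkAlgHom_surjective ℂ[X] (Rel τ) a
  induction b using SkewMonoidAlgebra.induction_on with
  | zero => simp
  | single g p =>
    have h : SkewMonoidAlgebra.single g p =
        coeffToSkew G p * SkewMonoidAlgebra.of FreeXY G g := by
      change _ = SkewMonoidAlgebra.single 1 p * SkewMonoidAlgebra.single g 1
      rw [SkewMonoidAlgebra.single_mul_single]
      simp
    rw [h, map_mul, ← grpA_apply]
    refine hfree p _ ((hmem _).2 ⟨1, ?_⟩)
    simpa using mem_ordSpan (τ := τ) 0 0 g (k := 1) (by omega)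
  | add b c hb hc => rw [map_add]; exact add_mem hb hc

end Spanning

/-! ### Symbols -/

section HahnLow

variable {E : Type*} [Ring E]

theorem coeff_mul_low {a b : HahnSeries ℤ E} {p q : ℤ} (ha : ∀ n < p, a.coeff n = 0)
    (hb : ∀ n < q, b.coeff n = 0) :
    (∀ n < p + q, (a * b).coeff n = 0) ∧ (a * b).coeff (p + q) = a.coeff p * b.coeff q := by
  have hle : ∀ i, a.coeff i ≠ 0 → p ≤ i := fun i hi => not_lt.1 fun h => hi (ha i h)
  have hle' : ∀ i, b.coeff i ≠ 0 → q ≤ i := fun i hi => not_lt.1 fun h => hi (hb i h)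
  constructor
  · intro n hn
    rw [HahnSeries.coeff_mul]
    refine Finset.sum_eq_zero fun x hx => ?_
    rw [Finset.mem_antidiagonal] at hx
    have h1 := hle _ hx.1
    have h2 := hle' _ hx.2.1
    have h3 := hx.2.2
    omega
  · rw [HahnSeries.coeff_mul]
    rw [Finset.sum_eq_single (p, q)]
    · intro x hx hne
      rw [Finset.mem_antidiagonal] at hx
      have h1 := hle _ hx.1
      have h2 := hle' _ hx.2.1
      have h3 := hx.2.2
      exact absurd (Prod.ext (by dsimp only; omega) (by dsimp only; omega)) hne
    · intro hx
      rw [Finset.mem_antidiagonal] at hx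
      by_contra h
      exact hx ⟨left_ne_zero_of_mul h, right_ne_zero_of_mul h, rfl⟩

end HahnLow

/-- An element of `R[x, y] # G` is homogeneous of degree `k` if all its coefficients are. -/
def Homog {G : Subgroup SL(2, ℂ)} (k : ℤ) (b : PolySkew G) : Prop :=
  ∀ g m, MvPolynomial.coeff m (b.coeff g) ≠ 0 → (m.degree : ℤ) = k

section Homog

variable {G : Subgroup SL(2, ℂ)}

theorem Homog.zero (k : ℤ) : Homog k (0 : PolySkew G) := fun g m h => by simp at h

theorem Homog.add {k : ℤ} {b c : PolySkew G} (hb : Homog k b) (hc : Homog k c) :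
    Homog k (b + c) := by
  intro g m h
  by_contra hk
  refine h ?_
  rw [SkewMonoidAlgebra.coeff_add, Finsupp.add_apply, MvPolynomial.coeff_add,
    not_not.1 fun h' => hk (hb g m h'), not_not.1 fun h' => hk (hc g m h'), add_zero]

theorem Homog.smul {k : ℤ} {b : PolySkew G} (r : ℂ[X]) (hb : Homog k b) : Homog k (r • b) := by
  intro g m h
  refine hb g m fun h' => h ?_
  rw [SkewMonoidAlgebra.coeff_smul, Finsupp.smul_apply, MvPolynomial.coeff_smul, h', smul_zero]

theorem Homog.monomial (m : Fin 2 →₀ ℕ) (r : ℂ[X]) (g : G) :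
    Homog m.degree (SkewMonoidAlgebra.single g (MvPolynomial.monomial m r) : PolySkew G) := by
  classical
  intro h m' hm
  rw [SkewMonoidAlgebra.coeff_single_apply] at hm
  split_ifs at hm with h1
  · rw [MvPolynomial.coeff_monomial] at hm
    split_ifs at hm with h2
    · rw [h2]
    · simp at hm
  · simp at hm

end Homog

/-- A representation of `A^τ` by Laurent series that deforms a faithful representation of
`R[x, y] # G`. -/
structure SymbolRep {G : Subgroup SL(2, ℂ)} (τ : MonoidAlgebra ℂ[X] G) (E : Type*) [Ring E]
    [Algebra ℂ[X] E] where
  /-- The representation of `A^τ`. -/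
  rep : AlgA τ →ₐ[ℂ[X]] HahnSeries ℤ E
  /-- The representation of `R[x, y] # G`. -/
  sym : PolySkew G →ₐ[ℂ[X]] E
  sym_injective : Function.Injective sym
  rep_grp : ∀ g, rep (grpA τ g) = HahnSeries.C (sym (SkewMonoidAlgebra.of PolyXY G g))
  rep_gen_low : ∀ i, ∀ n < -1, (rep (genA τ i)).coeff n = 0
  rep_gen : ∀ i, (rep (genA τ i)).coeff (-1) =
    sym (SkewMonoidAlgebra.single 1 (MvPolynomial.X i))

namespace SymbolRep

variable {G : Subgroup SL(2, ℂ)} {τ : MonoidAlgebra ℂ[X] G} {E : Type*} [Ring E] [Algebra ℂ[X] E]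
  (S : SymbolRep τ E)

/-- The element `a` of `A^τ` has degree at most `k`, and its symbol in degree `k` is `b`. -/
def HasSym (k : ℤ) (a : AlgA τ) (b : PolySkew G) : Prop :=
  (∀ n < -k, (S.rep a).coeff n = 0) ∧ (S.rep a).coeff (-k) = S.sym b

variable {S}

theorem HasSym.mul {k l : ℤ} {a a' : AlgA τ} {b b' : PolySkew G} (h : S.HasSym k a b)
    (h' : S.HasSym l a' b') : S.HasSym (k + l) (a * a') (b * b') := by
  have := coeff_mul_low h.1 h'.1
  rw [HasSym, map_mul, map_mul, neg_add, ← h.2, ← h'.2]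
  exact this

theorem HasSym.add {k : ℤ} {a a' : AlgA τ} {b b' : PolySkew G} (h : S.HasSym k a b)
    (h' : S.HasSym k a' b') : S.HasSym k (a + a') (b + b') := by
  refine ⟨fun n hn => ?_, ?_⟩
  · rw [map_add, HahnSeries.coeff_add, h.1 n hn, h'.1 n hn, add_zero]
  · rw [map_add, HahnSeries.coeff_add, h.2, h'.2, map_add]

theorem HasSym.sub {k : ℤ} {a a' : AlgA τ} {b b' : PolySkew G} (h : S.HasSym k a b)
    (h' : S.HasSym k a' b') : S.HasSym k (a - a') (b - b') := by
  refine ⟨fun n hn => ?_, ?_⟩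
  · rw [map_sub, HahnSeries.coeff_sub, h.1 n hn, h'.1 n hn, sub_zero]
  · rw [map_sub, HahnSeries.coeff_sub, h.2, h'.2, map_sub]

theorem HasSym.smul {k : ℤ} {a : AlgA τ} {b : PolySkew G} (r : ℂ[X]) (h : S.HasSym k a b) :
    S.HasSym k (r • a) (r • b) := by
  refine ⟨fun n hn => ?_, ?_⟩
  · rw [map_smul, HahnSeries.coeff_smul, h.1 n hn, smul_zero]
  · rw [map_smul, HahnSeries.coeff_smul, h.2, map_smul]

theorem HasSym.zero (k : ℤ) : S.HasSym k 0 0 := by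
  refine ⟨fun n hn => ?_, ?_⟩ <;> simp

theorem HasSym.sum {ι : Type*} {k : ℤ} (s : Finset ι) {a : ι → AlgA τ} {b : ι → PolySkew G}
    (h : ∀ i ∈ s, S.HasSym k (a i) (b i)) : S.HasSym k (∑ i ∈ s, a i) (∑ i ∈ s, b i) := by
  classical
  induction s using Finset.induction_on with
  | empty => exact HasSym.zero k
  | insert i s hi ih =>
    rw [Finset.sum_insert hi, Finset.sum_insert hi]
    exact (h i (Finset.mem_insert_self _ _)).add (ih fun j hj => h j (Finset.mem_insert_of_mem hj))

theorem HasSym.unique {k : ℤ} {a : AlgA τ} {b b' : PolySkew G} (h : S.HasSym k a b)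
    (h' : S.HasSym k a b') : b = b' :=
  S.sym_injective (h.2.symm.trans h'.2)

theorem HasSym.of_lt {k l : ℤ} {a : AlgA τ} {b : PolySkew G} (h : S.HasSym k a b) (hl : k < l) :
    S.HasSym l a 0 :=
  ⟨fun n hn => h.1 n (by omega), by rw [h.1 _ (by omega), map_zero]⟩

theorem hasSym_grp (g : G) : S.HasSym 0 (grpA τ g) (SkewMonoidAlgebra.of PolyXY G g) := by
  refine ⟨fun n hn => ?_, ?_⟩
  · rw [S.rep_grp, HahnSeries.C_apply, HahnSeries.coeff_single_of_ne (by omega)]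
  · rw [S.rep_grp, HahnSeries.C_apply, neg_zero, HahnSeries.coeff_single_same]

theorem hasSym_one : S.HasSym 0 1 1 := by
  simpa using hasSym_grp (S := S) 1

theorem hasSym_gen (i : Fin 2) :
    S.HasSym 1 (genA τ i) (SkewMonoidAlgebra.single 1 (MvPolynomial.X i)) :=
  ⟨S.rep_gen_low i, S.rep_gen i⟩

theorem HasSym.pow {k : ℤ} {a : AlgA τ} {b : PolySkew G} (h : S.HasSym k a b) (n : ℕ) :
    S.HasSym (n * k) (a ^ n) (b ^ n) := by
  induction n with
  | zero => simpa using hasSym_one (S := S)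
  | succ n ih =>
    have := ih.mul h
    rw [pow_succ, pow_succ]
    convert this using 1
    push_cast; ring

theorem monomial_fin_two (m : Fin 2 →₀ ℕ) (r : ℂ[X]) :
    (MvPolynomial.monomial m r : PolyXY) =
      r • (MvPolynomial.X 0 ^ m 0 * MvPolynomial.X 1 ^ m 1) := by
  rw [MvPolynomial.monomial_eq, Finsupp.prod_fintype _ _ (by simp), Fin.prod_univ_two,
    MvPolynomial.C_mul']

theorem degree_fin_two (m : Fin 2 →₀ ℕ) : m.degree = m 0 + m 1 := by
  rw [Finsupp.degree_eq_sum, Fin.sum_univ_two]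

theorem hasSym_monomial (m : Fin 2 →₀ ℕ) (r : ℂ[X]) (g : G) :
    S.HasSym m.degree (r • (genA τ 0 ^ m 0 * genA τ 1 ^ m 1 * grpA τ g))
      (SkewMonoidAlgebra.single g (MvPolynomial.monomial m r)) := by
  have h := ((((hasSym_gen (S := S) 0).pow (m 0)).mul ((hasSym_gen (S := S) 1).pow (m 1))).mul
    (hasSym_grp g)).smul r
  have h1 : ∀ p : PolyXY, (SkewMonoidAlgebra.single 1 p : PolySkew G) =
    SkewMonoidAlgebra.singleOneRingHom p := fun _ => rfl
  rw [h1, h1, ← map_pow, ← map_pow, ← map_mul, ← h1, SkewMonoidAlgebra.of_apply,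
    SkewMonoidAlgebra.single_mul_single, SkewMonoidAlgebra.smul_single] at h
  rw [degree_fin_two, monomial_fin_two]
  simpa using h

theorem coeff_finset_sum {ι : Type*} (s : Finset ι) (f : ι → PolySkew G) (g : G) :
    (∑ i ∈ s, f i).coeff g = ∑ i ∈ s, (f i).coeff g := by
  classical
  induction s using Finset.induction_on with
  | empty => simp
  | insert i s hi ih => simp [Finset.sum_insert hi, ih]

variable [Fintype G]

/-- The lift of an element of `R[x, y] # G` to a combination of ordered monomials. -/
def ordLift (τ : MonoidAlgebra ℂ[X] G) (b : PolySkew G) : AlgA τ :=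
  ∑ g : G, ((MvPolynomial.basisMonomials (Fin 2) ℂ[X]).constr ℂ[X]
    (fun m => genA τ 0 ^ m 0 * genA τ 1 ^ m 1) (b.coeff g)) * grpA τ g

theorem ordLift_add (b c : PolySkew G) : ordLift τ (b + c) = ordLift τ b + ordLift τ c := by
  simp only [ordLift, SkewMonoidAlgebra.coeff_add, Finsupp.add_apply, map_add, add_mul,
    Finset.sum_add_distrib]

theorem ordLift_smul (r : ℂ[X]) (b : PolySkew G) : ordLift τ (r • b) = r • ordLift τ b := by
  simp only [ordLift, SkewMonoidAlgebra.coeff_smul, Finsupp.smul_apply, map_smul, smul_mul_assoc,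
    Finset.smul_sum]

theorem ordLift_zero : ordLift τ (0 : PolySkew G) = 0 := by
  simpa using ordLift_smul (τ := τ) 0 0

theorem ordLift_sum {ι : Type*} (s : Finset ι) (f : ι → PolySkew G) :
    ordLift τ (∑ i ∈ s, f i) = ∑ i ∈ s, ordLift τ (f i) := by
  classical
  induction s using Finset.induction_on with
  | empty => simp [ordLift_zero]
  | insert i s hi ih => rw [Finset.sum_insert hi, Finset.sum_insert hi, ordLift_add, ih]

theorem ordLift_monomial (m : Fin 2 →₀ ℕ) (r : ℂ[X]) (g : G) :
    ordLift τ (SkewMonoidAlgebra.single g (MvPolynomial.monomial m r)) =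
      r • (genA τ 0 ^ m 0 * genA τ 1 ^ m 1 * grpA τ g) := by
  classical
  have h : (MvPolynomial.monomial m r : PolyXY) =
      r • MvPolynomial.basisMonomials (Fin 2) ℂ[X] m := by
    rw [MvPolynomial.coe_basisMonomials, MvPolynomial.smul_monomial, smul_eq_mul, mul_one]
  rw [ordLift, Finset.sum_eq_single g]
  · rw [SkewMonoidAlgebra.coeff_single, Finsupp.single_eq_same, h, map_smul,
      Module.Basis.constr_basis, smul_mul_assoc]
  · intro g' _ hg
    rw [SkewMonoidAlgebra.coeff_single, Finsupp.single_eq_of_ne hg, map_zero, zero_mul]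
  · simp

theorem eq_sum_monomial (b : PolySkew G) :
    b = ∑ g : G, ∑ m ∈ (b.coeff g).support,
      SkewMonoidAlgebra.single g (MvPolynomial.monomial m ((b.coeff g).coeff m)) := by
  classical
  ext1 h
  rw [coeff_finset_sum, Finset.sum_eq_single h]
  · rw [coeff_finset_sum]
    simp only [SkewMonoidAlgebra.coeff_single, Finsupp.single_eq_same]
    exact (MvPolynomial.support_sum_monomial_coeff _).symm
  · intro g _ hg
    rw [coeff_finset_sum]
    simp only [SkewMonoidAlgebra.coeff_single, Finsupp.single_eq_of_ne hg.symm,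
      Finset.sum_const_zero]
  · simp

theorem hasSym_ordLift {k : ℤ} {b : PolySkew G} (hb : Homog k b) :
    S.HasSym k (ordLift τ b) b := by
  have h := eq_sum_monomial b
  have h2 : S.HasSym k (ordLift τ (∑ g : G, ∑ m ∈ (b.coeff g).support,
      SkewMonoidAlgebra.single g (MvPolynomial.monomial m ((b.coeff g).coeff m))))
      (∑ g : G, ∑ m ∈ (b.coeff g).support,
        SkewMonoidAlgebra.single g (MvPolynomial.monomial m ((b.coeff g).coeff m))) := by
    rw [ordLift_sum]
    refine HasSym.sum _ fun g _ => ?_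
    rw [ordLift_sum]
    refine HasSym.sum _ fun m hm => ?_
    rw [ordLift_monomial, ← hb g m (MvPolynomial.mem_support_iff.1 hm)]
    exact hasSym_monomial m _ g
  rwa [← h] at h2

theorem exists_sub_ordLift_mem (k : ℕ) {a : AlgA τ} (ha : a ∈ ordSpan τ (k + 1)) :
    ∃ b : PolySkew G, Homog k b ∧ a - ordLift τ b ∈ ordSpan τ k := by
  induction ha using Submodule.span_induction with
  | mem a ha =>
    obtain ⟨i, j, g, hk, rfl⟩ := ha
    rcases Nat.lt_succ_iff_lt_or_eq.1 hk with h | h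
    · exact ⟨0, Homog.zero _, by simpa [ordLift_zero] using mem_ordSpan i j g h⟩
    · set m : Fin 2 →₀ ℕ := Finsupp.equivFunOnFinite.symm ![i, j] with hm
      have h0 : m 0 = i := rfl
      have h1 : m 1 = j := rfl
      refine ⟨SkewMonoidAlgebra.single g (MvPolynomial.monomial m 1), ?_, ?_⟩
      · have := Homog.monomial m 1 g
        rwa [degree_fin_two, h0, h1, h] at this
      · rw [ordLift_monomial, h0, h1, one_smul, sub_self]
        exact zero_mem _
  | zero => exact ⟨0, Homog.zero _, by simp [ordLift_zero]⟩
  | add a a' _ _ ha ha' =>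
    obtain ⟨b, hb, h⟩ := ha
    obtain ⟨b', hb', h'⟩ := ha'
    refine ⟨b + b', hb.add hb', ?_⟩
    rw [ordLift_add, add_sub_add_comm]
    exact add_mem h h'
  | smul r a _ ha =>
    obtain ⟨b, hb, h⟩ := ha
    refine ⟨r • b, hb.smul r, ?_⟩
    rw [ordLift_smul, ← smul_sub]
    exact Submodule.smul_mem _ _ h

theorem hasSym_of_mem_ordSpan {k : ℕ} {a : AlgA τ} (ha : a ∈ ordSpan τ k) : S.HasSym k a 0 := by
  induction ha using Submodule.span_induction with
  | mem a ha =>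
    obtain ⟨i, j, g, hk, rfl⟩ := ha
    set m : Fin 2 →₀ ℕ := Finsupp.equivFunOnFinite.symm ![i, j] with hm
    have h := hasSym_monomial (S := S) m 1 g
    rw [one_smul, degree_fin_two] at h
    exact h.of_lt (by exact_mod_cast hk)
  | zero => exact HasSym.zero _
  | add a a' _ _ ha ha' => simpa using ha.add ha'
  | smul r a _ ha => simpa using ha.smul r

variable (S)

/-- Every nonzero element of `A^τ` has a nonzero symbol. -/
theorem exists_hasSym_ne_zero {a : AlgA τ} (ha : a ≠ 0) :
    ∃ (k : ℕ) (b : PolySkew G), b ≠ 0 ∧ Homog k b ∧ S.HasSym k a b := by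
  obtain ⟨k, hk⟩ := exists_mem_ordSpan a
  induction k with
  | zero =>
    have : ordSpan τ 0 = ⊥ := by
      rw [ordSpan, Submodule.span_eq_bot]
      rintro _ ⟨i, j, g, h, _⟩
      omega
    rw [this] at hk
    exact absurd hk ha
  | succ k ih =>
    -- Split off the part `b` of degree `k`. If it vanishes, the degree bound drops; otherwise it is
    -- the symbol, as shorter monomials contribute nothing at $t^{-k}$.
    obtain ⟨b, hb, h⟩ := exists_sub_ordLift_mem k hk
    by_cases h0 : b = 0
    · rw [h0, ordLift_zero, sub_zero] at h
      exact ih h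
    · refine ⟨k, b, h0, hb, ?_⟩
      have := (hasSym_of_mem_ordSpan (S := S) h).add (hasSym_ordLift hb)
      simpa using this

/-- The lowest coefficient of the image is the image of a nonzero symbol under the faithful `S.sym`.
-/
theorem rep_injective : Function.Injective S.rep := by
  rw [injective_iff_map_eq_zero]
  intro a ha
  by_contra h0
  obtain ⟨k, b, hb, -, h⟩ := S.exists_hasSym_ne_zero h0
  have := h.2
  rw [ha, HahnSeries.coeff_zero, ← map_zero S.sym] at this
  exact hb (S.sym_injective this).symm

/-- The elements of degree at most `k`. -/
def DegLE (k : ℤ) (a : AlgA τ) : Prop := ∀ n < -k, (S.rep a).coeff n = 0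

variable {S}

theorem HasSym.degLE {k : ℤ} {a : AlgA τ} {b : PolySkew G} (h : S.HasSym k a b) : S.DegLE k a :=
  h.1

/-- Pole order and degree in ordered monomials agree: a nonzero symbol in degree above `k` would be
a nonzero coefficient forbidden by the bound. -/
theorem DegLE.exists_hasSym {k : ℤ} {a : AlgA τ} (h : S.DegLE k a) :
    ∃ b : PolySkew G, Homog k b ∧ S.HasSym k a b := by
  by_cases h0 : a = 0
  · exact ⟨0, Homog.zero k, h0 ▸ HasSym.zero k⟩
  · obtain ⟨l, b, hb, hl, hs⟩ := S.exists_hasSym_ne_zero h0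
    rcases lt_trichotomy (l : ℤ) k with h1 | h1 | h1
    · exact ⟨0, Homog.zero k, hs.of_lt h1⟩
    · exact ⟨b, h1 ▸ hl, h1 ▸ hs⟩
    · have := hs.2
      rw [h _ (by omega), ← map_zero S.sym] at this
      exact absurd (S.sym_injective this).symm hb

/-- Nonzero symbols live in degrees $\ge 0$. This is what makes successive approximation terminate.
-/
theorem DegLE.eq_zero {k : ℤ} {a : AlgA τ} (h : S.DegLE k a) (hk : k < 0) : a = 0 := by
  by_contra h0
  obtain ⟨l, b, hb, hl, hs⟩ := S.exists_hasSym_ne_zero h0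
  have := hs.2
  rw [h _ (by omega), ← map_zero S.sym] at this
  exact absurd (S.sym_injective this).symm hb

theorem HasSym.degLE_pred {k : ℤ} {a : AlgA τ} (h : S.HasSym k a 0) : S.DegLE (k - 1) a := by
  intro n hn
  rcases lt_or_eq_of_le (show n ≤ -k by omega) with h1 | h1
  · exact h.1 n h1
  · rw [h1, h.2, map_zero]

theorem exists_degLE (S : SymbolRep τ E) (a : AlgA τ) : ∃ k : ℤ, S.DegLE k a := by
  by_cases h0 : a = 0
  · exact ⟨0, fun n _ => by simp [h0]⟩
  · obtain ⟨l, b, -, -, hs⟩ := S.exists_hasSym_ne_zero h0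
    exact ⟨l, hs.1⟩

theorem DegLE.mul {k l : ℤ} {a b : AlgA τ} (ha : S.DegLE k a) (hb : S.DegLE l b) :
    S.DegLE (k + l) (a * b) := by
  obtain ⟨_, -, h⟩ := ha.exists_hasSym
  obtain ⟨_, -, h'⟩ := hb.exists_hasSym
  exact (h.mul h').1

theorem DegLE.sub {k : ℤ} {a b : AlgA τ} (ha : S.DegLE k a) (hb : S.DegLE k b) :
    S.DegLE k (a - b) := by
  intro n hn
  rw [map_sub, HahnSeries.coeff_sub, ha n hn, hb n hn, sub_zero]

theorem DegLE.add {k : ℤ} {a b : AlgA τ} (ha : S.DegLE k a) (hb : S.DegLE k b) :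
    S.DegLE k (a + b) := by
  intro n hn
  rw [map_add, HahnSeries.coeff_add, ha n hn, hb n hn, add_zero]

theorem DegLE.mono {k l : ℤ} {a : AlgA τ} (ha : S.DegLE k a) (h : k ≤ l) : S.DegLE l a :=
  fun n hn => ha n (by omega)

end SymbolRep

/-! ### Existence of symbol representations -/

section Existence

variable {G : Subgroup SL(2, ℂ)} {E : Type*} [Ring E] [Algebra ℂ[X] E]

theorem polySkew_of_mul (g : G) (p : PolyXY) :
    SkewMonoidAlgebra.of PolyXY G g * SkewMonoidAlgebra.single 1 p =
      SkewMonoidAlgebra.single 1 (g • p) * SkewMonoidAlgebra.of PolyXY G g := by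
  rw [SkewMonoidAlgebra.of_apply, SkewMonoidAlgebra.single_mul_single,
    SkewMonoidAlgebra.single_mul_single]
  simp

/-- Correcting only $x$ reduces the linearised equation to a commutator equation with $y$. -/
theorem wedge_pair_zero (w : Fin 2 → E) (ξ : E) :
    wedge w ![ξ, 0] + wedge ![ξ, 0] w = ξ * w 1 - w 1 * ξ := by
  simp [wedge, sub_eq_neg_add]

/-- Reduces the existence of a deformation to linear algebra in `E`; centrality of $\tau$ makes its
image $G$-invariant, as the averaging requires. -/
theorem exists_symbolRep [Fintype G] (τ : Subalgebra.center ℂ[X] (MonoidAlgebra ℂ[X] G))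
    (sym : PolySkew G →ₐ[ℂ[X]] E) (hsym : Function.Injective sym)
    (P : Submodule ℂ[X] E) (hP : ∀ a b : E, a * b - b * a ∈ P)
    (hT : MonoidAlgebra.lift ℂ[X] E G
      ((sym : PolySkew G →* E).comp (SkewMonoidAlgebra.of PolyXY G)) τ.1 ∈ P)
    (hsolve : ∀ e ∈ P, (∀ g, sym (SkewMonoidAlgebra.of PolyXY G g) * e =
        e * sym (SkewMonoidAlgebra.of PolyXY G g)) →
      ∃ a : Fin 2 → E, wedge (fun i => sym (SkewMonoidAlgebra.single 1 (MvPolynomial.X i))) a +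
        wedge a (fun i => sym (SkewMonoidAlgebra.single 1 (MvPolynomial.X i))) = e) :
    ∃ S : SymbolRep τ.1 E, S.sym = sym := by
  set γ : G →* E := (sym : PolySkew G →* E).comp (SkewMonoidAlgebra.of PolyXY G) with hγ
  set w : Fin 2 → E := fun i => sym (SkewMonoidAlgebra.single 1 (MvPolynomial.X i)) with hw
  have hwe : Equivariant γ w := by
    intro g j
    have h := congrArg sym (polySkew_of_mul g (MvPolynomial.X j))
    rw [smul_polyXY, polySubst_X, Fin.sum_univ_two, SkewMonoidAlgebra.single_add,
      ← SkewMonoidAlgebra.smul_single, ← SkewMonoidAlgebra.smul_single, map_mul, map_mul, map_add,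
      map_smul, map_smul] at h
    rw [Fin.sum_univ_two]
    exact h
  have hwc : w 0 * w 1 = w 1 * w 0 := by
    simp only [hw]
    rw [← map_mul, ← map_mul, SkewMonoidAlgebra.single_mul_single,
      SkewMonoidAlgebra.single_mul_single, one_smul, one_smul, mul_comm (MvPolynomial.X 0)]
  have hTG : ∀ g, γ g * MonoidAlgebra.lift ℂ[X] E G γ τ.1 =
      MonoidAlgebra.lift ℂ[X] E G γ τ.1 * γ g := by
    intro g
    have h := Subalgebra.mem_center_iff.1 τ.2 (MonoidAlgebra.of ℂ[X] G g)
    have h2 := congrArg (MonoidAlgebra.lift ℂ[X] E G γ) h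
    simpa using h2
  obtain ⟨v, v0, hv, hr⟩ := exists_deformSeq γ w hwe hwc P hP hT hTG hsolve
  obtain ⟨ρ, h1, h2⟩ := exists_laurent τ.1 γ v hv hr
  exact ⟨⟨ρ, sym, hsym, h1, fun i => (h2 i).1, fun i => by rw [(h2 i).2, v0]⟩, rfl⟩

end Existence

/-! ### The polynomial representation -/

section PolyRep

variable {G : Subgroup SL(2, ℂ)}

theorem coeff_polySubst_X (g : SL(2, ℂ)) (i j : Fin 2) :
    MvPolynomial.coeff (Finsupp.single i 1) (polySubst g (MvPolynomial.X j)) =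
      Polynomial.C (g.1 i j) := by
  rw [polySubst_X, MvPolynomial.coeff_sum, Finset.sum_eq_single i]
  · simp
  · intro k _ hk
    rw [MvPolynomial.coeff_smul, MvPolynomial.coeff_X, if_neg, smul_zero]
    intro h
    exact hk (Finsupp.single_left_injective one_ne_zero h)
  · simp

theorem eq_of_polySubst_X {g h : SL(2, ℂ)}
    (H : ∀ j, polySubst g (MvPolynomial.X j) = polySubst h (MvPolynomial.X j)) : g = h := by
  ext i j
  apply Polynomial.C_injective
  rw [← coeff_polySubst_X, ← coeff_polySubst_X, H]

/-- The representation of `R[x, y] # G` on `R[x, y]`. -/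
def polyRep (G : Subgroup SL(2, ℂ)) : PolySkew G →ₐ[ℂ[X]] Module.End ℂ[X] PolyXY :=
  SkewMonoidAlgebra.liftNCAlgHom (Algebra.lmul ℂ[X] PolyXY)
    { toFun := fun g : G => (polySubst g.1).toLinearMap
      map_one' := by rw [OneMemClass.coe_one, polySubst_one]; rfl
      map_mul' := fun g h => by
        refine LinearMap.ext fun p => ?_
        simp [polySubst_mul] } (by
    intro p g
    refine LinearMap.ext fun q => ?_
    simp [smul_polyXY])

theorem polyRep_single (g : G) (p q : PolyXY) :
    polyRep G (SkewMonoidAlgebra.single g p) q = p * polySubst g.1 q := by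
  have h : polyRep G (SkewMonoidAlgebra.single g p) =
    Algebra.lmul ℂ[X] PolyXY p * (polySubst g.1).toLinearMap := SkewMonoidAlgebra.liftNC_single _ _ _ _
  rw [h]
  rfl

variable [Fintype G]

theorem sum_single_coeff (b : PolySkew G) :
    b = ∑ g : G, SkewMonoidAlgebra.single g (b.coeff g) := by
  classical
  ext1 h
  rw [SymbolRep.coeff_finset_sum, Finset.sum_eq_single h]
  · simp
  · intro g _ hg
    simp [Finsupp.single_eq_of_ne hg.symm]
  · simp

/-- Distinct elements of $G$ give distinct substitutions, and distinct multiplicative maps into a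
domain are linearly independent (Dedekind). -/
theorem polyRep_injective : Function.Injective (polyRep G) := by
  rw [injective_iff_map_eq_zero]
  intro b hb
  have hinj : Function.Injective fun g : G => ((polySubst g.1 : PolyXY →ₐ[ℂ[X]] PolyXY) :
      PolyXY →* PolyXY) := by
    intro g h hgh
    exact Subtype.ext (eq_of_polySubst_X fun j => DFunLike.congr_fun hgh (MvPolynomial.X j))
  have hli := (linearIndependent_monoidHom PolyXY PolyXY).comp _ hinj
  rw [Fintype.linearIndependent_iff] at hli
  ext1 g
  refine hli (fun g => b.coeff g) ?_ g
  funext q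
  have h := congrArg (fun φ : Module.End ℂ[X] PolyXY => φ q) hb
  rw [sum_single_coeff b, map_sum] at h
  simp only [LinearMap.sum_apply, polyRep_single, LinearMap.zero_apply] at h
  simpa [Finset.sum_apply] using h

/-- Multiplication by `y` on `R[x, y]` has surjective commutator map. -/
theorem exists_commutator_mulY (e : Module.End ℂ[X] PolyXY) :
    ∃ ξ : Module.End ℂ[X] PolyXY, ∀ p : PolyXY,
      ξ (MvPolynomial.X 1 * p) - MvPolynomial.X 1 * ξ p = e p := by
  -- Solving $\xi(yp)=y\,\xi(p)+e(p)$ recursively from $\xi(x^i)=0$ gives this sum; in the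
  -- commutator only the term $t=0$ survives.
  set f : (Fin 2 →₀ ℕ) → PolyXY := fun m => ∑ t ∈ Finset.range (m 1),
    MvPolynomial.X 1 ^ t * e (MvPolynomial.X 0 ^ m 0 * MvPolynomial.X 1 ^ (m 1 - 1 - t)) with hf
  set ξ := (MvPolynomial.basisMonomials (Fin 2) ℂ[X]).constr ℂ[X] f with hξ
  have hmon : ∀ m, ξ (MvPolynomial.monomial m 1) = f m := by
    intro m
    have := (MvPolynomial.basisMonomials (Fin 2) ℂ[X]).constr_basis ℂ[X] f m
    rwa [MvPolynomial.coe_basisMonomials] at this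
  refine ⟨ξ, fun p => ?_⟩
  have hlin : ξ ∘ₗ LinearMap.mulLeft ℂ[X] (MvPolynomial.X 1) -
      LinearMap.mulLeft ℂ[X] (MvPolynomial.X 1) ∘ₗ ξ = e := by
    refine (MvPolynomial.basisMonomials (Fin 2) ℂ[X]).ext fun m => ?_
    rw [MvPolynomial.coe_basisMonomials]
    simp only [LinearMap.sub_apply, LinearMap.comp_apply, LinearMap.mulLeft_apply]
    have h1 : (MvPolynomial.X 1 * MvPolynomial.monomial m 1 : PolyXY) =
        MvPolynomial.monomial (m + Finsupp.single 1 1) 1 := by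
      rw [mul_comm, MvPolynomial.X, MvPolynomial.monomial_mul, one_mul]
    rw [h1, hmon, hmon]
    simp only [hf, Finsupp.add_apply, Finsupp.single_eq_same]
    rw [Finsupp.single_eq_of_ne (by decide), add_zero, Finset.sum_range_succ', Finset.mul_sum]
    have h2 : ∀ t, (MvPolynomial.X 1 : PolyXY) ^ (t + 1) *
        e (MvPolynomial.X 0 ^ m 0 * MvPolynomial.X 1 ^ (m 1 + 1 - 1 - (t + 1))) =
        MvPolynomial.X 1 * (MvPolynomial.X 1 ^ t *
          e (MvPolynomial.X 0 ^ m 0 * MvPolynomial.X 1 ^ (m 1 - 1 - t))) := by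
      intro t
      rw [← mul_assoc, ← pow_succ', show m 1 + 1 - 1 - (t + 1) = m 1 - 1 - t by omega]
    rw [Finset.sum_congr rfl fun t _ => h2 t, add_sub_cancel_left, SymbolRep.monomial_fin_two]
    simp
  exact LinearMap.congr_fun hlin p

theorem nonempty_polySymbolRep (τ : Subalgebra.center ℂ[X] (MonoidAlgebra ℂ[X] G)) :
    Nonempty (SymbolRep τ.1 (Module.End ℂ[X] PolyXY)) := by
  refine Exists.nonempty (exists_symbolRep τ (polyRep G) polyRep_injective ⊤
    (fun _ _ => trivial) trivial fun e _ _ => ?_)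
  obtain ⟨ξ, hξ⟩ := exists_commutator_mulY e
  refine ⟨![ξ, 0], ?_⟩
  rw [wedge_pair_zero]
  refine LinearMap.ext fun p => ?_
  change ξ (polyRep G _ p) - polyRep G _ (ξ p) = e p
  have h1 : ∀ q : PolyXY, polySubst (1 : G).1 q = q := fun q => by
    rw [← smul_polyXY, one_smul]
  rw [polyRep_single, polyRep_single, h1, h1, hξ]

end PolyRep

/-! ### The generic regular representation -/

section RegularRep

variable {G : Subgroup SL(2, ℂ)} [Fintype G]

/-- The field of rational functions in `x` and `y`. -/
abbrev RatXY : Type := FractionRing PolyXY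

open scoped Classical in
/-- The regular representation of the group, on functions on a generic orbit. -/
def regPerm (G : Subgroup SL(2, ℂ)) [Fintype G] : G →* Matrix G G RatXY where
  toFun g := Matrix.of fun k h => if h = k * g then 1 else 0
  map_one' := by
    ext k h
    simp [Matrix.one_apply, eq_comm]
  map_mul' g g' := by
    ext k h
    rw [Matrix.mul_apply, Finset.sum_eq_single (k * g)]
    · simp [mul_assoc]
    · intro l _ hl
      simp [hl]
    · simp

open scoped Classical in
theorem regPerm_apply (g k h : G) : regPerm G g k h = if h = k * g then 1 else 0 := rfl

open scoped Classical in
/-- The action of `R[x, y]` on functions on a generic orbit. -/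
def orbitDiag (G : Subgroup SL(2, ℂ)) [Fintype G] : PolyXY →ₐ[ℂ[X]] Matrix G G RatXY :=
  (Matrix.diagonalAlgHom ℂ[X]).comp (AlgHom.pi fun k : G =>
    (IsScalarTower.toAlgHom ℂ[X] PolyXY RatXY).comp (polySubst k.1))

open scoped Classical in
theorem orbitDiag_apply (p : PolyXY) : orbitDiag G p =
    Matrix.diagonal fun k : G => algebraMap PolyXY RatXY (k • p) := rfl

open scoped Classical in
theorem orbitDiag_mul_regPerm_apply (p : PolyXY) (g k h : G) :
    (orbitDiag G p * regPerm G g) k h =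
      if h = k * g then algebraMap PolyXY RatXY (k • p) else 0 := by
  rw [orbitDiag_apply, Matrix.diagonal_mul, regPerm_apply, mul_ite, mul_one, mul_zero]

open scoped Classical in
theorem regPerm_mul_apply (M : Matrix G G RatXY) (g k h : G) :
    (regPerm G g * M) k h = M (k * g) h := by
  rw [Matrix.mul_apply, Finset.sum_eq_single (k * g)]
  · simp [regPerm]
  · intro l _ hl
    simp [regPerm, hl]
  · simp

open scoped Classical in
theorem mul_regPerm_apply (M : Matrix G G RatXY) (g k h : G) :
    (M * regPerm G g) k h = M k (h * g⁻¹) := by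
  rw [Matrix.mul_apply, Finset.sum_eq_single (h * g⁻¹)]
  · simp [regPerm]
  · intro l _ hl
    have : h ≠ l * g := fun h' => hl (by rw [h', mul_inv_cancel_right])
    simp [regPerm, this]
  · simp

open scoped Classical in
/-- The representation of `R[x, y] # G` by matrices over the field of fractions of `R[x, y]`, on
functions on a generic orbit. -/
def orbitRep (G : Subgroup SL(2, ℂ)) [Fintype G] : PolySkew G →ₐ[ℂ[X]] Matrix G G RatXY :=
  SkewMonoidAlgebra.liftNCAlgHom (orbitDiag G) (regPerm G) (by
    intro p g
    ext k h
    rw [orbitDiag_mul_regPerm_apply, regPerm_mul_apply, orbitDiag_apply, Matrix.diagonal_apply,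
      smul_smul]
    simp only [eq_comm])

open scoped Classical in
theorem orbitRep_single (g : G) (p : PolyXY) (k h : G) :
    orbitRep G (SkewMonoidAlgebra.single g p) k h =
      if h = k * g then algebraMap PolyXY RatXY (k • p) else 0 := by
  have h1 : orbitRep G (SkewMonoidAlgebra.single g p) = orbitDiag G p * regPerm G g :=
    SkewMonoidAlgebra.liftNC_single _ _ _ _
  rw [h1, orbitDiag_mul_regPerm_apply]

open scoped Classical in
theorem orbitRep_of (g : G) : orbitRep G (SkewMonoidAlgebra.of PolyXY G g) = regPerm G g := by
  have h1 : orbitRep G (SkewMonoidAlgebra.single g 1) = orbitDiag G 1 * regPerm G g :=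
    SkewMonoidAlgebra.liftNC_single _ _ _ _
  rw [SkewMonoidAlgebra.of_apply, h1, map_one, one_mul]

open scoped Classical in
-- The row of the matrix at the point $1$ lists the coefficients of the element.
theorem orbitRep_injective : Function.Injective (orbitRep G) := by
  rw [injective_iff_map_eq_zero]
  intro b hb
  ext1 g
  have h := congrFun (congrFun hb 1) g
  rw [sum_single_coeff b, map_sum, Matrix.sum_apply, Finset.sum_eq_single g, orbitRep_single,
    if_pos (one_mul g).symm, one_smul] at h
  · exact IsFractionRing.injective PolyXY RatXY (by simpa using h)
  · intro g' _ hg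
    rw [orbitRep_single, if_neg (by rw [one_mul]; exact hg.symm)]
  · simp

open scoped Classical in
-- Here `P` is the space of traceless matrices. A group element $g\ne1$ permutes the orbit without
-- fixed points, so the trace of the image of $\tau$ sees only its coefficient at $1$.
theorem exists_orbitSymbolRep (τ : Subalgebra.center ℂ[X] (MonoidAlgebra ℂ[X] G))
    (hτ : τ.1.coeff 1 = 0) :
    ∃ S : SymbolRep τ.1 (Matrix G G RatXY), S.sym = orbitRep G := by
  set P : Submodule ℂ[X] (Matrix G G RatXY) :=
    LinearMap.ker (Matrix.traceLinearMap G ℂ[X] RatXY) with hP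
  have hmemP : ∀ M, M ∈ P ↔ M.trace = 0 := fun M => Iff.rfl
  refine exists_symbolRep τ (orbitRep G) orbitRep_injective P (fun a b => ?_) ?_ ?_
  · rw [hmemP, Matrix.trace_sub, Matrix.trace_mul_comm, sub_self]
  · rw [hmemP, MonoidAlgebra.lift_apply, Finsupp.sum, Matrix.trace_sum]
    refine Finset.sum_eq_zero fun g _ => ?_
    rw [Matrix.trace_smul]
    by_cases hg : g = 1
    · rw [hg, hτ, zero_smul]
    · have : (orbitRep G (SkewMonoidAlgebra.of PolyXY G g)).trace = 0 := by
        rw [orbitRep_of, Matrix.trace]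
        refine Finset.sum_eq_zero fun k _ => ?_
        simp [regPerm, hg]
      exact (congrArg _ this).trans (smul_zero _)
  · intro e he hG
    rw [hmemP] at he
    have hinv : ∀ g k h : G, e (k * g) h = e k (h * g⁻¹) := by
      intro g k h
      have := congrFun (congrFun (hG g) k) h
      rwa [orbitRep_of, regPerm_mul_apply, mul_regPerm_apply] at this
    have hdiag : ∀ k, e k k = e 1 1 := by
      intro k
      have := hinv k 1 k
      rwa [one_mul, mul_inv_cancel] at this
    -- Invariance makes the diagonal constant because the action on the orbit is transitive; trace
    -- zero then makes it vanish.
    have h0 : ∀ k, e k k = 0 := by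
      have h1 : (Fintype.card G : RatXY) * e 1 1 = 0 := by
        rw [← he, Matrix.trace]
        simp [Matrix.diag_apply, hdiag]
      intro k
      rw [hdiag]
      rcases mul_eq_zero.1 h1 with h | h
      · simp at h
      · exact h
    set x : Fin 2 → G → RatXY := fun i k =>
      algebraMap PolyXY RatXY (k • (MvPolynomial.X i : PolyXY)) with hx
    have hne : ∀ k h : G, x 0 k = x 0 h → x 1 k = x 1 h → k = h := by
      intro k h h1 h2
      refine Subtype.ext (eq_of_polySubst_X fun j => ?_)
      fin_cases j
      · exact IsFractionRing.injective PolyXY RatXY h1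
      · exact IsFractionRing.injective PolyXY RatXY h2
    -- The equation at $(k,h)$ is $(x_k-x_h)a_1+(y_h-y_k)a_0=e_{kh}$. Distinct orbit points differ
    -- in some coordinate, and one divides by that difference. On the diagonal the division by zero
    -- is harmless, since $e_{kk}=0$.
    refine ⟨![Matrix.of fun k h => if x 0 k = x 0 h then e k h / (x 1 h - x 1 k) else 0,
      Matrix.of fun k h => if x 0 k = x 0 h then 0 else e k h / (x 0 k - x 0 h)], ?_⟩
    have hdg : ∀ i, orbitRep G (SkewMonoidAlgebra.single 1 (MvPolynomial.X i)) =
        Matrix.diagonal (x i) := by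
      intro i
      ext k h
      rw [orbitRep_single, mul_one, Matrix.diagonal_apply]
      simp only [eq_comm, hx]
    ext k h
    simp only [wedge, hdg, Matrix.add_apply, Matrix.sub_apply, Matrix.diagonal_mul,
      Matrix.mul_diagonal, Matrix.cons_val_zero, Matrix.cons_val_one, Matrix.of_apply]
    by_cases h1 : x 0 k = x 0 h
    · simp only [h1, if_true]
      by_cases h2 : x 1 k = x 1 h
      · rw [hne k h h1 h2, h0]
        simp
      · have : x 1 h - x 1 k ≠ 0 := sub_ne_zero.2 (Ne.symm h2)
        field_simp
        ring
    · have : x 0 k - x 0 h ≠ 0 := sub_ne_zero.2 h1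
      simp only [h1, if_false]
      field_simp
      ring

end RegularRep

/-! ### The trace condition -/

section TraceCondition

variable {H : Type*} [Group H] [Fintype H]

/-- In the basis of group elements every diagonal entry of left multiplication is the coefficient at
$1$. -/
theorem trace_mulLeft_monoidAlgebra (a : MonoidAlgebra ℂ H) :
    LinearMap.trace ℂ _ (LinearMap.mulLeft ℂ a) = Fintype.card H * a.coeff 1 := by
  classical
  rw [LinearMap.trace_eq_matrix_trace ℂ (MonoidAlgebra.basis H ℂ), Matrix.trace]
  have h : ∀ h : H, (LinearMap.toMatrix (MonoidAlgebra.basis H ℂ) (MonoidAlgebra.basis H ℂ)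
      (LinearMap.mulLeft ℂ a)).diag h = a.coeff 1 := by
    intro h
    rw [Matrix.diag_apply, LinearMap.toMatrix_apply, LinearMap.mulLeft_apply]
    have h1 : (MonoidAlgebra.basis H ℂ) h = MonoidAlgebra.single h 1 := by simp
    have h2 : ∀ b : MonoidAlgebra ℂ H, (MonoidAlgebra.basis H ℂ).repr b h = b.coeff h := by
      intro b; rfl
    rw [h1, h2]
    simp
  rw [Finset.sum_congr rfl fun g _ => h g]
  simp

variable {I : Type*} [Fintype I] [DecidableEq I] {δ : I → ℕ}
  (Φ : MonoidAlgebra ℂ H ≃ₐ[ℂ] Π i, Matrix (Fin (δ i)) (Fin (δ i)) ℂ)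

/-- Left multiplication by the idempotent is the projection onto the $i$-th block, so its trace is
the dimension of that block. -/
theorem card_mul_blockIdem_coeff (i : I) :
    (Fintype.card H : ℂ) * (blockIdem Φ i).coeff 1 = (δ i : ℂ) ^ 2 := by
  rw [← trace_mulLeft_monoidAlgebra]
  have hconj : Φ.toLinearEquiv.conj (LinearMap.mulLeft ℂ (blockIdem Φ i)) =
      LinearMap.mulLeft ℂ (Pi.single i 1) := by
    refine LinearMap.ext fun x => ?_
    rw [LinearEquiv.conj_apply_apply, LinearMap.mulLeft_apply, LinearMap.mulLeft_apply]
    change Φ (blockIdem Φ i * Φ.symm x) = _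
    rw [map_mul, blockIdem, AlgEquiv.apply_symm_apply, AlgEquiv.apply_symm_apply]
  rw [← LinearMap.trace_conj' _ Φ.toLinearEquiv, hconj]
  set p := LinearMap.range (LinearMap.single ℂ
    (fun i => Matrix (Fin (δ i)) (Fin (δ i)) ℂ) i) with hp
  have hinj : Function.Injective (LinearMap.single ℂ
      (fun i => Matrix (Fin (δ i)) (Fin (δ i)) ℂ) i) := by
    intro a b h
    simpa using congrFun h i
  have hproj : LinearMap.IsProj p (LinearMap.mulLeft ℂ
      (Pi.single i 1 : Π i, Matrix (Fin (δ i)) (Fin (δ i)) ℂ)) := by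
    constructor
    · intro x
      refine ⟨x i, ?_⟩
      funext j
      by_cases h : j = i
      · subst h; simp
      · simp [h]
    · rintro _ ⟨m, rfl⟩
      funext j
      by_cases h : j = i
      · subst h; simp
      · simp [h]
  rw [hproj.trace, LinearMap.finrank_range_of_inj hinj,
    Module.finrank_matrix]
  simp [sq]

/-- The block weight $\delta_i^2$ meets the factor $1/\delta_i$ in the definition of the components,
leaving $\delta_i$. -/
theorem card_smul_ofComponents_coeff (hδ : ∀ i, δ i ≠ 0) (t : I → ℂ[X]) :
    (Fintype.card H : ℂ[X]) * (ofComponents Φ t).1.coeff 1 = ∑ i, (δ i : ℂ[X]) * t i := by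
  have hco : ∀ a : MonoidAlgebra ℂ H, (incl a).coeff 1 = Polynomial.C (a.coeff 1) := by
    intro a
    simp [incl]
  have hsum : ∀ f : I → MonoidAlgebra ℂ[X] H, (∑ i, f i).coeff 1 = ∑ i, (f i).coeff 1 := by
    intro f
    simp
  simp only [ofComponents, hsum, Finset.mul_sum, MonoidAlgebra.coeff_smul, Finsupp.smul_apply, hco]
  refine Finset.sum_congr rfl fun i _ => ?_
  have h := congrArg Polynomial.C (card_mul_blockIdem_coeff Φ i)
  have h2 : Polynomial.C ((δ i : ℂ)⁻¹) * (δ i : ℂ[X]) = 1 := by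
    rw [← Polynomial.C_eq_natCast, ← Polynomial.C_mul, inv_mul_cancel₀ (Nat.cast_ne_zero.2 (hδ i)),
      Polynomial.C_1]
  rw [Polynomial.C_mul, Polynomial.C_pow, Polynomial.C_eq_natCast, Polynomial.C_eq_natCast] at h
  rw [smul_eq_mul]
  linear_combination Polynomial.C ((δ i : ℂ)⁻¹) * t i * h + (δ i : ℂ[X]) * t i * h2

theorem coeff_one_eq_zero_of_sum_eq_zero [∀ i, NeZero (δ i)]
    (τ : Subalgebra.center ℂ[X] (MonoidAlgebra ℂ[X] H))
    (h : ∑ i, (δ i : ℂ[X]) * (centerEquiv Φ).symm τ i = 0) : τ.1.coeff 1 = 0 := by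
  have h1 := card_smul_ofComponents_coeff Φ (fun i => NeZero.ne (δ i)) ((centerEquiv Φ).symm τ)
  have h2 : ofComponents Φ ((centerEquiv Φ).symm τ) = τ := (centerEquiv Φ).apply_symm_apply τ
  rw [h, h2] at h1
  rcases mul_eq_zero.1 h1 with h3 | h3
  · simp at h3
  · exact h3

end TraceCondition

/-! ### Commutativity of the spherical subalgebra -/

section Spherical

variable {G : Subgroup SL(2, ℂ)} [Fintype G]

theorem idem_eq (τ : MonoidAlgebra ℂ[X] G) :
    idem τ = (Polynomial.C ((Fintype.card G : ℂ)⁻¹) : ℂ[X]) • ∑ g : G, grpA τ g := by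
  rw [idem, average, map_smul, map_sum]
  rfl

theorem SymbolRep.rep_idem {τ : MonoidAlgebra ℂ[X] G} {E : Type*} [Ring E] [Algebra ℂ[X] E]
    (S : SymbolRep τ E) : S.rep (idem τ) = HahnSeries.C (S.sym
      ((Polynomial.C ((Fintype.card G : ℂ)⁻¹) : ℂ[X]) •
        ∑ g : G, SkewMonoidAlgebra.of PolyXY G g)) := by
  simp only [idem_eq, map_smul, map_sum, S.rep_grp]
  ext n
  by_cases hn : n = 0 <;> simp [HahnSeries.coeff_smul, HahnSeries.C_apply, hn]

theorem mul_comm_of_const {n K : Type*} [Fintype n] [CommRing K] {M N : Matrix n n K} (a b : K)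
    (hM : ∀ i j, M i j = a) (hN : ∀ i j, N i j = b) : M * N = N * M := by
  ext i j
  simp [Matrix.mul_apply, hM, hN, mul_comm]

open scoped Classical in
-- In the orbit representation $e$ is the constant matrix `J`. Elements of $e A^\tau e$ have all
-- Laurent coefficients of the form $JMJ$, hence constant, and such matrices commute pairwise.
theorem commute_of_coeff_one_eq_zero (τ : Subalgebra.center ℂ[X] (MonoidAlgebra ℂ[X] G))
    (hτ : τ.1.coeff 1 = 0) (a b : AlgC τ.1) : a * b = b * a := by
  obtain ⟨S, hS⟩ := exists_orbitSymbolRep τ hτ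
  obtain ⟨_, a, rfl⟩ := a
  obtain ⟨_, b, rfl⟩ := b
  apply Subtype.ext
  apply S.rep_injective
  change S.rep ((idem τ.1 * a * idem τ.1) * (idem τ.1 * b * idem τ.1)) =
    S.rep ((idem τ.1 * b * idem τ.1) * (idem τ.1 * a * idem τ.1))
  set r : ℂ[X] := Polynomial.C ((Fintype.card G : ℂ)⁻¹) with hr
  set J : Matrix G G RatXY := S.sym (r • ∑ g : G, SkewMonoidAlgebra.of PolyXY G g) with hJ
  have hJc : ∀ k h, J k h = r • 1 := by
    intro k h
    rw [hJ, hS, map_smul, map_sum, Matrix.smul_apply, Matrix.sum_apply,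
      Finset.sum_eq_single (k⁻¹ * h)]
    · rw [orbitRep_of, regPerm_apply, if_pos (by group)]
    · intro g _ hg
      rw [orbitRep_of, regPerm_apply, if_neg]
      rintro rfl
      exact hg (by group)
    · simp
  have hJM : ∀ M : Matrix G G RatXY, ∃ c, ∀ k h, (J * M * J) k h = c := by
    intro M
    refine ⟨∑ l, (∑ m, (r • 1) * M m l) * (r • 1), fun k h => ?_⟩
    simp only [Matrix.mul_apply, hJc]
  have hrep : ∀ (c : AlgA τ.1) (n : ℤ), (S.rep (idem τ.1 * c * idem τ.1)).coeff n =
      J * (S.rep c).coeff n * J := by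
    intro c n
    rw [map_mul, map_mul, S.rep_idem, HahnSeries.C_apply, HahnSeries.coeff_mul_single_zero,
      HahnSeries.coeff_single_zero_mul]
  rw [map_mul S.rep (idem τ.1 * a * idem τ.1), map_mul S.rep (idem τ.1 * b * idem τ.1)]
  apply commute_of_coeff
  intro i j
  rw [hrep, hrep]
  obtain ⟨c, hc⟩ := hJM ((S.rep a).coeff i)
  obtain ⟨d, hd⟩ := hJM ((S.rep b).coeff j)
  exact mul_comm_of_const c d hc hd

end Spherical

/-! ### Linear forms -/

section LinearForms

variable {G : Subgroup SL(2, ℂ)}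

/-- The linear form with coefficient vector `u`. -/
def linForm (u : Fin 2 → ℂ) : PolyXY := ∑ i, Polynomial.C (u i) • MvPolynomial.X i

theorem smul_linForm (g : SL(2, ℂ)) (u : Fin 2 → ℂ) :
    g • linForm u = linForm (Matrix.mulVec g.1 u) := by
  change polySubst g _ = _
  simp only [linForm, map_sum, map_smul, polySubst_X]
  simp only [Fin.sum_univ_two, Matrix.mulVec, dotProduct, Polynomial.C_add, Polynomial.C_mul]
  module

theorem linForm_sub (u v : Fin 2 → ℂ) : linForm (u - v) = linForm u - linForm v := by
  simp only [linForm, Fin.sum_univ_two, Pi.sub_apply, Polynomial.C_sub]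
  module

theorem linForm_single (i : Fin 2) : linForm (Pi.single i 1) = MvPolynomial.X i := by
  fin_cases i <;> simp [linForm]

/-- By Cayley–Hamilton $n=g-1$ has square zero, so $g^k=1+kn$; finite order in characteristic zero
forces $n=0$. -/
theorem eq_one_of_trace_eq_two {g : SL(2, ℂ)} (hg : IsOfFinOrder g) (ht : g.1.trace = 2) :
    g = 1 := by
  obtain ⟨m, hm, hgm⟩ := isOfFinOrder_iff_pow_eq_one.1 hg
  have hd := g.2
  rw [Matrix.det_fin_two] at hd
  rw [Matrix.trace_fin_two] at ht
  set n : Matrix (Fin 2) (Fin 2) ℂ := g.1 - 1 with hn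
  have hn2 : n * n = 0 := by
    ext i j
    fin_cases i <;> fin_cases j <;>
      simp [hn, Matrix.mul_apply, Fin.sum_univ_two, Matrix.sub_apply]
    · linear_combination g.1 0 0 * ht - hd
    · linear_combination g.1 0 1 * ht
    · linear_combination g.1 1 0 * ht
    · linear_combination g.1 1 1 * ht - hd
  have hpow : ∀ k : ℕ, g.1 ^ k = 1 + (k : ℂ) • n := by
    intro k
    induction k with
    | zero => simp
    | succ k ih =>
      have : g.1 = 1 + n := by rw [hn]; abel
      rw [pow_succ, ih, this]
      rw [add_mul, one_mul, mul_add, mul_one, smul_mul_assoc, hn2, smul_zero]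
      push_cast
      module
  have h1 : g.1 ^ m = 1 := by
    rw [← Matrix.SpecialLinearGroup.coe_pow, hgm, Matrix.SpecialLinearGroup.coe_one]
  rw [hpow, add_eq_left, smul_eq_zero] at h1
  rcases h1 with h1 | h1
  · exact absurd h1 (Nat.cast_ne_zero.2 hm.ne')
  · exact Subtype.ext (sub_eq_zero.1 h1)

/-- $\det(1-g^{-1})=2-\mathrm{tr}(g^{-1})$ is nonzero, so $1-g^{-1}$ is invertible on linear forms.
-/
theorem exists_linForm_sub [Finite G] {g : G} (hg : g ≠ 1) (i : Fin 2) :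
    ∃ u : Fin 2 → ℂ, linForm u - g⁻¹ • linForm u = MvPolynomial.X i := by
  set M : Matrix (Fin 2) (Fin 2) ℂ := 1 - (g⁻¹ : G).1.1 with hM
  have hdet : M.det ≠ 0 := by
    intro h
    have hfin : IsOfFinOrder (g⁻¹ : G).1 :=
      Submonoid.isOfFinOrder_coe.2 (isOfFinOrder_of_finite g⁻¹)
    have h1 : (g⁻¹ : G).1 = 1 := by
      refine eq_one_of_trace_eq_two hfin ?_
      have hd := (g⁻¹ : G).1.2
      rw [Matrix.det_fin_two] at hd h
      rw [Matrix.trace_fin_two]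
      simp only [hM, Matrix.sub_apply, Matrix.one_apply_eq, ne_eq, zero_ne_one, not_false_eq_true,
        one_ne_zero, Matrix.one_apply_ne] at h
      linear_combination hd - h
    exact hg (inv_eq_one.1 (Subtype.ext h1))
  refine ⟨Matrix.mulVec M⁻¹ (Pi.single i 1), ?_⟩
  rw [Subgroup.smul_def, smul_linForm, ← linForm_sub, ← linForm_single]
  congr 1
  have h2 : Matrix.mulVec M (Matrix.mulVec M⁻¹ (Pi.single i 1)) = Pi.single i 1 := by
    rw [Matrix.mulVec_mulVec, Matrix.mul_nonsing_inv _ (isUnit_iff_ne_zero.2 hdet),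
      Matrix.one_mulVec]
  rwa [hM, Matrix.sub_mulVec, Matrix.one_mulVec] at h2

theorem isHomogeneous_linForm (u : Fin 2 → ℂ) : (linForm u).IsHomogeneous 1 := by
  refine MvPolynomial.IsHomogeneous.sum _ _ _ fun i _ => ?_
  rw [← MvPolynomial.C_mul']
  exact (MvPolynomial.isHomogeneous_X _ i).C_mul _

theorem isHomogeneous_smul (g : SL(2, ℂ)) {p : PolyXY} {n : ℕ} (hp : p.IsHomogeneous n) :
    (g • p).IsHomogeneous n := by
  have h := hp.aeval (fun j => ∑ i : Fin 2, Polynomial.C (g.1 i j) • (MvPolynomial.X i : PolyXY))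
    (n := 1) fun j => isHomogeneous_linForm fun i => g.1 i j
  rwa [one_mul] at h

theorem homog_single {p : PolyXY} {n : ℕ} (hp : p.IsHomogeneous n) :
    Homog n (SkewMonoidAlgebra.single 1 p : PolySkew G) := by
  classical
  intro h m hm
  rw [SkewMonoidAlgebra.coeff_single_apply] at hm
  split_ifs at hm with h1
  · by_contra hne
    exact hm (hp.coeff_eq_zero fun h => hne (by exact_mod_cast h))
  · simp at hm

/-- Substitutions preserve homogeneity. -/
theorem coeff_smul_ne_zero {k : ℤ} {p : PolyXY}
    (hp : ∀ m, MvPolynomial.coeff m p ≠ 0 → (m.degree : ℤ) = k) (g : SL(2, ℂ)) (m : Fin 2 →₀ ℕ)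
    (hm : MvPolynomial.coeff m (g • p) ≠ 0) : (m.degree : ℤ) = k := by
  by_cases h0 : p = 0
  · rw [h0, smul_zero] at hm
    simp at hm
  · obtain ⟨m0, hm0⟩ := MvPolynomial.ne_zero_iff.1 h0
    have hp' : p.IsHomogeneous m0.degree := by
      intro m hm
      have h1 := hp m hm
      have h2 := hp m0 hm0
      have h3 : m.degree = m0.degree := by omega
      rw [← h3, Finsupp.degree_eq_weight_one]
      rfl
    have h4 := isHomogeneous_smul g hp'
    have h5 : m.degree = m0.degree := by
      by_contra h
      exact hm (h4.coeff_eq_zero h)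
    rw [h5, hp m0 hm0]

/-- The variable $x$ is prime and does not divide $y^N$, so all of $x^N$ divides $a$. -/
theorem exists_homogeneous_quotient {N : ℕ} {k : ℤ} {a b : PolyXY}
    (ha : ∀ m, MvPolynomial.coeff m a ≠ 0 → (m.degree : ℤ) = N + k)
    (hab : a * MvPolynomial.X 1 ^ N = b * MvPolynomial.X 0 ^ N) :
    ∃ q : PolyXY, (∀ m, MvPolynomial.coeff m q ≠ 0 → (m.degree : ℤ) = k) ∧
      q * MvPolynomial.X 0 ^ N = a := by
  have hprime : Prime (MvPolynomial.X 0 : PolyXY) := MvPolynomial.X_prime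
  have hnd : ¬ (MvPolynomial.X 0 : PolyXY) ∣ MvPolynomial.X 1 ^ N := by
    intro h
    have := MvPolynomial.X_dvd_X.1 (hprime.dvd_of_dvd_pow h)
    simp at this
  obtain ⟨q, hq⟩ := hprime.pow_dvd_of_dvd_mul_right N hnd
    (show MvPolynomial.X 0 ^ N ∣ a * MvPolynomial.X 1 ^ N from hab ▸ dvd_mul_left _ _)
  refine ⟨q, fun m hm => ?_, by rw [hq, mul_comm]⟩
  · have h1 : MvPolynomial.coeff (m + Finsupp.single 0 N) a = MvPolynomial.coeff m q := by
      rw [hq, mul_comm, MvPolynomial.X_pow_eq_monomial, MvPolynomial.coeff_mul_monomial, mul_one]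
    have h2 := ha (m + Finsupp.single 0 N) (by rwa [h1])
    rw [map_add, Finsupp.degree_single] at h2
    push_cast at h2
    omega

end LinearForms

/-! ### Elements of `AeA` with prescribed symbols -/

section Graph

variable {G : Subgroup SL(2, ℂ)} [Fintype G] {τ : MonoidAlgebra ℂ[X] G}

/-- The graph of the map `peq ↦ pcq` on the ideal generated by `e`. -/
def cornerGraph (τ : MonoidAlgebra ℂ[X] G) (c : AlgA τ) : AddSubgroup (AlgA τ × AlgA τ) :=
  AddSubgroup.closure {x | ∃ p q, x = (p * idem τ * q, p * c * q)}

theorem cornerGraph_mem (c p q : AlgA τ) : (p * idem τ * q, p * c * q) ∈ cornerGraph τ c :=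
  AddSubgroup.subset_closure ⟨p, q, rfl⟩

theorem cornerGraph_mul_left {c : AlgA τ} (a : AlgA τ) {x : AlgA τ × AlgA τ}
    (hx : x ∈ cornerGraph τ c) : (a * x.1, a * x.2) ∈ cornerGraph τ c := by
  induction hx using AddSubgroup.closure_induction with
  | mem x hx =>
    obtain ⟨p, q, rfl⟩ := hx
    simpa only [mul_assoc] using cornerGraph_mem c (a * p) q
  | zero => simp only [Prod.fst_zero, Prod.snd_zero, mul_zero]; exact zero_mem _
  | add x y _ _ hx hy =>
    simp only [Prod.fst_add, Prod.snd_add, mul_add]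
    exact add_mem hx hy
  | neg x _ hx =>
    simp only [Prod.fst_neg, Prod.snd_neg, mul_neg]
    exact neg_mem hx

theorem cornerGraph_mul_right {c : AlgA τ} (a : AlgA τ) {x : AlgA τ × AlgA τ}
    (hx : x ∈ cornerGraph τ c) : (x.1 * a, x.2 * a) ∈ cornerGraph τ c := by
  induction hx using AddSubgroup.closure_induction with
  | mem x hx =>
    obtain ⟨p, q, rfl⟩ := hx
    simpa only [mul_assoc] using cornerGraph_mem c p (q * a)
  | zero => simp only [Prod.fst_zero, Prod.snd_zero, zero_mul]; exact zero_mem _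
  | add x y _ _ hx hy =>
    simp only [Prod.fst_add, Prod.snd_add, add_mul]
    exact add_mem hx hy
  | neg x _ hx =>
    simp only [Prod.fst_neg, Prod.snd_neg, neg_mul]
    exact neg_mem hx

/-- The elements of the graph satisfy `θ(w) w' = w θ(w')`, for `c` central in `eAe`. -/
theorem cornerGraph_exchange {c : AlgA τ} (h1 : idem τ * c = c) (h2 : c * idem τ = c)
    (hc : ∀ a, c * (idem τ * a * idem τ) = idem τ * a * idem τ * c) {x y : AlgA τ × AlgA τ}
    (hx : x ∈ cornerGraph τ c) (hy : y ∈ cornerGraph τ c) : x.2 * y.1 = x.1 * y.2 := by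
  induction hx using AddSubgroup.closure_induction with
  | mem x hx =>
    obtain ⟨p, q, rfl⟩ := hx
    induction hy using AddSubgroup.closure_induction with
    | mem y hy =>
      obtain ⟨p', q', rfl⟩ := hy
      have he := idem_isIdempotent τ
      -- Inserting $c=ce=ec$ reduces this to `c` commuting with $e(qp')e$.
      have h3 : c * (q * p') * idem τ = idem τ * (q * p') * c := by
        have h4 := hc (q * p')
        calc c * (q * p') * idem τ = c * (idem τ * (q * p') * idem τ) := by
              rw [mul_assoc (idem τ), ← mul_assoc c (idem τ), h2, mul_assoc]
          _ = idem τ * (q * p') * (idem τ * c) := by rw [h4, mul_assoc]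
          _ = _ := by rw [h1]
      calc p * c * q * (p' * idem τ * q') = p * (c * (q * p') * idem τ) * q' := by
            simp only [mul_assoc]
        _ = p * idem τ * q * (p' * c * q') := by rw [h3]; simp only [mul_assoc]
    | zero => simp
    | add y z _ _ hy hz => simp only [Prod.fst_add, Prod.snd_add, mul_add, hy, hz]
    | neg y _ hy => simp only [Prod.fst_neg, Prod.snd_neg, mul_neg, hy]
  | zero => simp
  | add x y _ _ hx hy => simp only [Prod.fst_add, Prod.snd_add, add_mul, hx, hy]
  | neg x _ hx => simp only [Prod.fst_neg, Prod.snd_neg, neg_mul, hx]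

theorem mul_fst_eq_zero {c z : AlgA τ} (hz : ∀ a, z * a = a * z) (h : z * idem τ = 0)
    {x : AlgA τ × AlgA τ} (hx : x ∈ cornerGraph τ c) : z * x.1 = 0 := by
  induction hx using AddSubgroup.closure_induction with
  | mem x hx =>
    obtain ⟨p, q, rfl⟩ := hx
    change z * (p * idem τ * q) = 0
    rw [← mul_assoc, ← mul_assoc, hz p, mul_assoc p, h, mul_zero, zero_mul]
  | zero => simp
  | add x y _ _ hx hy => rw [Prod.fst_add, mul_add, hx, hy, add_zero]
  | neg x _ hx => rw [Prod.fst_neg, mul_neg, hx, neg_zero]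

variable {E : Type*} [Ring E] [Algebra ℂ[X] E]

open SymbolRep

/-- The linear form with coefficient vector `u`, in `A^τ`. -/
def linA (τ : MonoidAlgebra ℂ[X] G) (u : Fin 2 → ℂ) : AlgA τ :=
  ∑ i, Polynomial.C (u i) • genA τ i

theorem hasSym_linA (S : SymbolRep τ E) (u : Fin 2 → ℂ) :
    S.HasSym 1 (linA τ u) (SkewMonoidAlgebra.single 1 (linForm u)) := by
  have h : (SkewMonoidAlgebra.single 1 (linForm u) : PolySkew G) =
      ∑ i, Polynomial.C (u i) • SkewMonoidAlgebra.single 1 (MvPolynomial.X i) := by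
    rw [linForm, Fin.sum_univ_two, Fin.sum_univ_two, SkewMonoidAlgebra.single_add,
      SkewMonoidAlgebra.smul_single, SkewMonoidAlgebra.smul_single]
  rw [h]
  exact HasSym.sum _ fun i _ => (hasSym_gen i).smul _

theorem single_one_mul_sum (p : PolyXY) (f : G → PolyXY) :
    (SkewMonoidAlgebra.single 1 p : PolySkew G) * ∑ g, SkewMonoidAlgebra.single g (f g) =
      ∑ g, SkewMonoidAlgebra.single g (p * f g) := by
  rw [Finset.mul_sum]
  refine Finset.sum_congr rfl fun g _ => ?_
  rw [SkewMonoidAlgebra.single_mul_single, one_mul, one_smul]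

theorem sum_mul_single_one (p : PolyXY) (f : G → PolyXY) :
    (∑ g, SkewMonoidAlgebra.single g (f g) : PolySkew G) * SkewMonoidAlgebra.single 1 p =
      ∑ g, SkewMonoidAlgebra.single g (f g * g • p) := by
  rw [Finset.sum_mul]
  refine Finset.sum_congr rfl fun g _ => ?_
  rw [SkewMonoidAlgebra.single_mul_single, mul_one]

/-- Starting from $|G|e=\sum g$, each step removes one $g_0\ne1$ from the symbol by a twisted
commutator $w\mapsto uw-wu'$ with linear forms. It multiplies the coefficient at $g$ by $u-g\cdot
u'$. With $u'=g_0^{-1}u$ this is zero at $g_0$, while at $1$ it is $u-g_0^{-1}u$, which can be made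
equal to the chosen variable. -/
theorem exists_mem_cornerGraph_hasSym_aux (S : SymbolRep τ E) (c : AlgA τ) (i : Fin 2)
    (s : Finset G) (hs : 1 ∉ s) : ∃ x ∈ cornerGraph τ c, ∃ f : G → PolyXY,
      S.HasSym s.card x.1 (∑ g, SkewMonoidAlgebra.single g (f g)) ∧
        f 1 = MvPolynomial.X i ^ s.card ∧ ∀ g ∈ s, f g = 0 := by
  classical
  induction s using Finset.induction_on with
  | empty =>
    refine ⟨_, cornerGraph_mem c (Fintype.card G : AlgA τ) 1, fun _ => 1, ?_, by simp, by simp⟩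
    have h : (Fintype.card G : AlgA τ) * idem τ * 1 = ∑ g : G, grpA τ g := by
      rw [mul_one, ← nsmul_eq_mul, idem_eq, smul_comm, card_C_smul]
    simp only [h]
    exact HasSym.sum _ fun g _ => hasSym_grp g
  | insert g0 s hg0 ih =>
    have hg1 : g0 ≠ 1 := fun h => hs (h ▸ Finset.mem_insert_self _ _)
    obtain ⟨x, hx, f, hsym, hf1, hf0⟩ := ih fun h => hs (Finset.mem_insert_of_mem h)
    obtain ⟨u, hu⟩ := exists_linForm_sub hg1 i
    set u' : Fin 2 → ℂ := Matrix.mulVec (g0⁻¹ : G).1.1 u with hu'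
    have hlu' : linForm u' = g0⁻¹ • linForm u := by
      rw [Subgroup.smul_def, smul_linForm]
    refine ⟨(linA τ u * x.1, linA τ u * x.2) - (x.1 * linA τ u', x.2 * linA τ u'),
      sub_mem (cornerGraph_mul_left _ hx) (cornerGraph_mul_right _ hx),
      fun g => linForm u * f g - f g * g • linForm u', ?_, ?_, ?_⟩
    · have h1 := (hasSym_linA S u).mul hsym
      have h2 := hsym.mul (hasSym_linA S u')
      rw [single_one_mul_sum, add_comm] at h1
      rw [sum_mul_single_one] at h2
      have h3 := h1.sub h2
      have h4 : (∑ g, SkewMonoidAlgebra.single g (linForm u * f g - f g * g • linForm u') :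
          PolySkew G) = ∑ g, SkewMonoidAlgebra.single g (linForm u * f g) -
            ∑ g, SkewMonoidAlgebra.single g (f g * g • linForm u') := by
        refine eq_sub_of_add_eq ?_
        rw [← Finset.sum_add_distrib]
        refine Finset.sum_congr rfl fun g _ => ?_
        rw [← SkewMonoidAlgebra.single_add, sub_add_cancel]
      rw [Finset.card_insert_of_notMem hg0, h4]
      exact_mod_cast h3
    · dsimp only
      rw [one_smul, hf1, hlu', Finset.card_insert_of_notMem hg0, ← mul_comm _ (linForm u),
        ← mul_sub, hu, pow_succ]
    · intro g hg
      dsimp only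
      rcases Finset.mem_insert.1 hg with rfl | hg
      · rw [hlu', smul_inv_smul, mul_comm, sub_self]
      · rw [hf0 g hg, mul_zero, zero_mul, sub_self]

theorem exists_mem_cornerGraph_hasSym (S : SymbolRep τ E) (c : AlgA τ) (i : Fin 2) :
    ∃ x ∈ cornerGraph τ c, S.HasSym (Fintype.card G - 1 : ℕ) x.1
      (SkewMonoidAlgebra.single 1 (MvPolynomial.X i ^ (Fintype.card G - 1))) := by
  classical
  obtain ⟨x, hx, f, hsym, hf1, hf0⟩ :=
    exists_mem_cornerGraph_hasSym_aux S c i (Finset.univ.erase 1) (by simp)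
  refine ⟨x, hx, ?_⟩
  rw [Finset.card_erase_of_mem (Finset.mem_univ _), Finset.card_univ] at hsym hf1
  rwa [Finset.sum_eq_single 1, hf1] at hsym
  · intro g _ hg
    rw [hf0 g (by simp [hg]), SkewMonoidAlgebra.single_zero]
  · simp

end Graph

/-! ### Bimodule maps on `AeA` are multiplications -/

section Extension

variable {G : Subgroup SL(2, ℂ)} [Fintype G] {τ : MonoidAlgebra ℂ[X] G} {E : Type*} [Ring E]
  [Algebra ℂ[X] E] {S : SymbolRep τ E}

open SymbolRep

theorem mul_single_one_eq_zero {b : PolySkew G} {p : PolyXY} (hp : p ≠ 0)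
    (h : b * SkewMonoidAlgebra.single 1 p = 0) : b = 0 := by
  ext1 g
  have h1 := congrArg (fun b => b.coeff g) h
  simp only [SkewMonoidAlgebra.coeff_mul_single_one, SkewMonoidAlgebra.coeff_zero,
    Finsupp.zero_apply] at h1
  rcases mul_eq_zero.1 h1 with h2 | h2
  · simpa using h2
  · exact absurd ((smul_eq_zero_iff_eq g).1 h2) hp

theorem mul_single_one_comm {p : PolyXY} (hp : ∀ g : G, g • p = p) (b : PolySkew G) :
    b * SkewMonoidAlgebra.single 1 p = SkewMonoidAlgebra.single 1 p * b := by
  ext1 g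
  rw [SkewMonoidAlgebra.coeff_mul_single_one, SkewMonoidAlgebra.coeff_single_one_mul, hp, mul_comm]

/-- Right multiplication by $p$ multiplies the coefficient at $g$ by $g\cdot p$; after twisting by
$g^{-1}$ the division takes place in $R[x,y]$, one coefficient at a time. -/
theorem exists_polySkew_quotient {N : ℕ} {k : ℤ} {α β : PolySkew G} (hα : Homog (N + k) α)
    (h : α * SkewMonoidAlgebra.single 1 (MvPolynomial.X 1 ^ N) =
      β * SkewMonoidAlgebra.single 1 (MvPolynomial.X 0 ^ N)) :
    ∃ c : PolySkew G, Homog k c ∧ c * SkewMonoidAlgebra.single 1 (MvPolynomial.X 0 ^ N) = α := by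
  classical
  have hq : ∀ g : G, ∃ q : PolyXY, (∀ m, MvPolynomial.coeff m q ≠ 0 → (m.degree : ℤ) = k) ∧
      q * MvPolynomial.X 0 ^ N = g⁻¹ • α.coeff g := by
    intro g
    refine exists_homogeneous_quotient (b := g⁻¹ • β.coeff g) (fun m hm =>
      coeff_smul_ne_zero (hα g) (g⁻¹ : G).1 m hm) ?_
    have h1 := congrArg (fun b => b.coeff g) h
    simp only [SkewMonoidAlgebra.coeff_mul_single_one] at h1
    have h2 := congrArg (fun p => g⁻¹ • p) h1
    simpa only [smul_mul', inv_smul_smul] using h2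
  choose q hq1 hq2 using hq
  have hco : ∀ g, (∑ g : G, SkewMonoidAlgebra.single g (g • q g) : PolySkew G).coeff g =
      g • q g := by
    intro g
    rw [coeff_finset_sum, Finset.sum_eq_single g]
    · simp
    · intro g' _ hg
      simp [Finsupp.single_eq_of_ne hg.symm]
    · simp
  refine ⟨∑ g : G, SkewMonoidAlgebra.single g (g • q g), fun g m hm => ?_, ?_⟩
  · rw [hco] at hm
    exact coeff_smul_ne_zero (hq1 g) g.1 m hm
  · ext1 g
    rw [SkewMonoidAlgebra.coeff_mul_single_one, hco, ← smul_mul', hq2, smul_inv_smul]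

theorem SymbolRep.HasSym.eq_zero_of_degLE {k : ℤ} {a : AlgA τ} {b : PolySkew G}
    (h : S.HasSym k a b) {l : ℤ} (ha : S.DegLE l a) (hl : l < k) : b = 0 := by
  apply S.sym_injective
  rw [← h.2, ha _ (by omega), map_zero]

/-- The norm $\nu=\prod_g g\cdot x^N$ is an invariant multiple of $x^N$, hence central in
$R[x,y]\#G$; `T` lifts the cofactor. -/
theorem exists_invariant_multiple (S : SymbolRep τ E) (N : ℕ) :
    ∃ (T : AlgA τ) (M : ℤ) (t ν : PolyXY), ν ≠ 0 ∧ (∀ g : G, g • ν = ν) ∧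
      MvPolynomial.X 0 ^ N * t = ν ∧ S.HasSym M T (SkewMonoidAlgebra.single 1 t) := by
  classical
  set p : G → PolyXY := fun g => g • (MvPolynomial.X 0 ^ N : PolyXY) with hp
  set t : PolyXY := ∏ g ∈ Finset.univ.erase (1 : G), p g with ht
  have hhom : t.IsHomogeneous (∑ _g ∈ Finset.univ.erase (1 : G), N) :=
    MvPolynomial.IsHomogeneous.prod _ _ _ fun g _ =>
      isHomogeneous_smul g.1 (MvPolynomial.isHomogeneous_X_pow _ _)
  refine ⟨ordLift τ (SkewMonoidAlgebra.single 1 t), _, t, ∏ g, p g, ?_, ?_, ?_,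
    hasSym_ordLift (homog_single hhom)⟩
  · refine Finset.prod_ne_zero_iff.2 fun g _ => ?_
    rw [hp]
    exact (smul_ne_zero_iff_ne g).2 (pow_ne_zero _ (MvPolynomial.X_ne_zero _))
  · intro g
    rw [Finset.smul_prod']
    refine Fintype.prod_equiv (Equiv.mulLeft g) _ _ fun h => ?_
    simp [hp, smul_smul]
  · rw [← Finset.mul_prod_erase Finset.univ p (Finset.mem_univ 1)]
    simp [hp, ht]

variable {Γ : AddSubgroup (AlgA τ × AlgA τ)}

/-- One step of the approximation of a right module map by a multiplication. -/
theorem exists_approx_step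
    (hΓ : ∀ x ∈ Γ, ∀ a, (x.1 * a, x.2 * a) ∈ Γ) {N : ℕ} {x1 x2 : AlgA τ × AlgA τ} (hx1 : x1 ∈ Γ)
    (hx2 : x2 ∈ Γ) (hs1 : S.HasSym N x1.1 (SkewMonoidAlgebra.single 1 (MvPolynomial.X 0 ^ N)))
    (hs2 : S.HasSym N x2.1 (SkewMonoidAlgebra.single 1 (MvPolynomial.X 1 ^ N)))
    {z : AlgA τ} {d : ℤ} (hd : ∀ x ∈ Γ, ∀ k, S.DegLE k x.1 → S.DegLE (k + d) (x.2 - z * x.1)) :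
    ∃ y, S.DegLE d y ∧
      ∀ x ∈ Γ, ∀ k, S.DegLE k x.1 → S.DegLE (k + (d - 1)) (x.2 - (z + y) * x.1) := by
  obtain ⟨α, hα, hsα⟩ := (hd x1 hx1 N hs1.degLE).exists_hasSym
  obtain ⟨β, hβ, hsβ⟩ := (hd x2 hx2 N hs2.degLE).exists_hasSym
  have hcomm : ∀ p q : PolyXY, (SkewMonoidAlgebra.single 1 p * SkewMonoidAlgebra.single 1 q :
      PolySkew G) = SkewMonoidAlgebra.single 1 q * SkewMonoidAlgebra.single 1 p := by
    intro p q
    rw [SkewMonoidAlgebra.single_mul_single, SkewMonoidAlgebra.single_mul_single, one_smul,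
      one_smul, mul_comm p]
  -- The commutator of `x1.1` and `x2.1` drops in degree because their symbols commute, so the
  -- defect of $\theta$ on it drops as well; right linearity makes this an identity between symbols.
  have hαβ : α * SkewMonoidAlgebra.single 1 (MvPolynomial.X 1 ^ N) =
      β * SkewMonoidAlgebra.single 1 (MvPolynomial.X 0 ^ N) := by
    have h1 := (hs1.mul hs2).sub (hs2.mul hs1)
    rw [hcomm, sub_self] at h1
    have h2 := hd _ (sub_mem (hΓ x1 hx1 x2.1) (hΓ x2 hx2 x1.1)) _ h1.degLE_pred
    have h3 := (hsα.mul hs2).sub (hsβ.mul hs1)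
    have h4 : (x1.2 - z * x1.1) * x2.1 - (x2.2 - z * x2.1) * x1.1 =
        ((x1.1 * x2.1, x1.2 * x2.1) - (x2.1 * x1.1, x2.2 * x1.1) : AlgA τ × AlgA τ).2 -
        z * ((x1.1 * x2.1, x1.2 * x2.1) - (x2.1 * x1.1, x2.2 * x1.1) : AlgA τ × AlgA τ).1 := by
      simp only [Prod.fst_sub, Prod.snd_sub]
      noncomm_ring
    rw [h4] at h3
    exact sub_eq_zero.1 (h3.eq_zero_of_degLE h2 (by omega))
  obtain ⟨c, hc, hcα⟩ := exists_polySkew_quotient hα hαβ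
  have hy := hasSym_ordLift (S := S) hc
  set y := ordLift τ c with hyd
  refine ⟨y, hy.degLE, fun x hx k hk => ?_⟩
  -- The new defect is already smaller on `x1`. To carry this to arbitrary `x`, compare $xF$ with
  -- $Fx$ for $F=x_1T$, whose symbol `ν` is central.
  obtain ⟨T, M, t, ν, hν0, hνG, hνt, hT⟩ := exists_invariant_multiple S N
  have hx1' : S.DegLE (N + d - 1) (x1.2 - (z + y) * x1.1) := by
    have h1 := hsα.sub (add_comm d (N : ℤ) ▸ hy.mul hs1)
    rw [hcα, sub_self] at h1
    have h2 : x1.2 - (z + y) * x1.1 = x1.2 - z * x1.1 - y * x1.1 := by noncomm_ring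
    rw [h2]
    exact h1.degLE_pred
  have hF : S.HasSym (N + M) (x1.1 * T) (SkewMonoidAlgebra.single 1 ν) := by
    have := hs1.mul hT
    rwa [SkewMonoidAlgebra.single_mul_single, one_smul, one_mul, hνt] at this
  have hθ : ∀ x ∈ Γ, ∀ k, S.DegLE k x.1 → S.DegLE (k + d) (x.2 - (z + y) * x.1) := by
    intro x hx k hk
    have h2 : x.2 - (z + y) * x.1 = x.2 - z * x.1 - y * x.1 := by noncomm_ring
    rw [h2]
    exact (hd x hx k hk).sub (add_comm d k ▸ hy.degLE.mul hk)
  obtain ⟨σ, -, hσ⟩ := (hθ x hx k hk).exists_hasSym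
  obtain ⟨ω, -, hω⟩ := hk.exists_hasSym
  have hmem := sub_mem (hΓ x hx (x1.1 * T)) (hΓ _ (hΓ x1 hx1 T) x.1)
  have hbr : S.DegLE (k + (N + M) - 1) (x.1 * (x1.1 * T) - x1.1 * T * x.1) := by
    have h1 := (hω.mul hF).sub (add_comm (N + M : ℤ) k ▸ hF.mul hω)
    rw [mul_single_one_comm hνG, sub_self] at h1
    exact h1.degLE_pred
  have h1 := hθ _ hmem _ hbr
  have h2 : S.DegLE (k + (N + M) - 1 + d) ((x1.2 - (z + y) * x1.1) * T * x.1) :=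
    ((hx1'.mul hT.degLE).mul hk).mono (by omega)
  -- Defect of $x$ times $F$ equals the defect of $xF-Fx$, small since the commutator drops in
  -- degree, plus the defect of $x_1$ times $Tx$, small by the choice of `y`. Cancelling `ν` then
  -- kills the symbol `σ`.
  have h3 : (x.2 - (z + y) * x.1) * (x1.1 * T) =
      (((x.1 * (x1.1 * T), x.2 * (x1.1 * T)) - (x1.1 * T * x.1, x1.2 * T * x.1) :
        AlgA τ × AlgA τ).2 - (z + y) * ((x.1 * (x1.1 * T), x.2 * (x1.1 * T)) -
          (x1.1 * T * x.1, x1.2 * T * x.1) : AlgA τ × AlgA τ).1) +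
      (x1.2 - (z + y) * x1.1) * T * x.1 := by
    simp only [Prod.fst_sub, Prod.snd_sub]
    noncomm_ring
  have h4 := h1.add h2
  rw [← h3] at h4
  have h5 := (hσ.mul hF).eq_zero_of_degLE h4 (by omega)
  rw [mul_single_one_eq_zero hν0 h5] at hσ
  exact hσ.degLE_pred.mono (by omega)

/-- Bounded degree allows finitely many nontrivial corrections to `z`; afterwards every correction
has negative degree and is zero, so one `z` works to all orders. Functionality of `Γ` is a
consequence rather than an assumption. -/
theorem exists_eq_mul
    (hΓ : ∀ x ∈ Γ, ∀ a, (x.1 * a, x.2 * a) ∈ Γ) {N : ℕ} {x1 x2 : AlgA τ × AlgA τ} (hx1 : x1 ∈ Γ)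
    (hx2 : x2 ∈ Γ) (hs1 : S.HasSym N x1.1 (SkewMonoidAlgebra.single 1 (MvPolynomial.X 0 ^ N)))
    (hs2 : S.HasSym N x2.1 (SkewMonoidAlgebra.single 1 (MvPolynomial.X 1 ^ N)))
    {d : ℤ} (hd : ∀ x ∈ Γ, ∀ k, S.DegLE k x.1 → S.DegLE (k + d) x.2) :
    ∃ z, ∀ x ∈ Γ, x.2 = z * x.1 := by
  have hdown : ∀ n : ℕ, ∃ z, ∀ x ∈ Γ, ∀ k, S.DegLE k x.1 →
      S.DegLE (k + (d - n)) (x.2 - z * x.1) := by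
    intro n
    induction n with
    | zero => exact ⟨0, fun x hx k hk => by simpa using hd x hx k hk⟩
    | succ n ih =>
      obtain ⟨z, hz⟩ := ih
      obtain ⟨y, -, hy⟩ := exists_approx_step hΓ hx1 hx2 hs1 hs2 hz
      refine ⟨z + y, fun x hx k hk => ?_⟩
      have := hy x hx k hk
      push_cast
      rwa [sub_sub] at this
  -- With $d^++1$ steps, where $d^+=\max(d,0)$, the defect has degree at most $-1$.
  obtain ⟨z, hz⟩ := hdown (d.toNat + 1)
  have hz' : ∀ n : ℕ, ∀ x ∈ Γ, ∀ k, S.DegLE k x.1 → S.DegLE (k + (-1 - n)) (x.2 - z * x.1) := by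
    intro n
    induction n with
    | zero => exact fun x hx k hk => (hz x hx k hk).mono (by push_cast; omega)
    | succ n ih =>
      obtain ⟨y, hy0, hy⟩ := exists_approx_step hΓ hx1 hx2 hs1 hs2 ih
      have h0 := hy0.eq_zero (by omega)
      intro x hx k hk
      have := hy x hx k hk
      rw [h0, add_zero] at this
      exact this.mono (by push_cast; omega)
  refine ⟨z, fun x hx => ?_⟩
  obtain ⟨k, hk⟩ := exists_degLE S x.1
  exact sub_eq_zero.1 ((hz' k.toNat x hx k hk).eq_zero (by omega))

end Extension

end FilteredRing

/-! ### The centres of `A^τ` and `C^τ` -/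

section Centre

variable {G : Subgroup SL(2, ℂ)} [Fintype G]

section Lift

attribute [local instance] algARing

theorem mul_right_injective_of_hasSym {τ : MonoidAlgebra ℂ[X] G} {E : Type*} [Ring E]
    [Algebra ℂ[X] E] {S : SymbolRep τ E} {k : ℤ} {F : AlgA τ} {p : PolyXY} (hp : p ≠ 0)
    (hF : S.HasSym k F (SkewMonoidAlgebra.single 1 p)) {a : AlgA τ} (h : a * F = 0) : a = 0 := by
  by_contra h0
  obtain ⟨l, b, hb, -, hs⟩ := S.exists_hasSym_ne_zero h0
  have h1 := hs.mul hF
  rw [h] at h1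
  exact hb (mul_single_one_eq_zero hp (h1.unique (SymbolRep.HasSym.zero _)))

/-- The element `z` represents the bimodule map $peq\mapsto pcq$ on $AeA$ as a left multiplication.
-/
theorem exists_central_lift (τ : Subalgebra.center ℂ[X] (MonoidAlgebra ℂ[X] G)) (c : AlgC τ.1)
    (hc : ∀ b, b * c = c * b) :
    ∃ z : AlgA τ.1, (∀ a, a * z = z * a) ∧ z * idem τ.1 = c.1 := by
  obtain ⟨S⟩ := nonempty_polySymbolRep τ
  have he := idem_isIdempotent τ.1
  obtain ⟨h1, h2⟩ := (Subsemigroup.mem_corner_iff he).mp c.2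
  have hc' : ∀ a, c.1 * (idem τ.1 * a * idem τ.1) = idem τ.1 * a * idem τ.1 * c.1 := fun a =>
    congrArg Subtype.val (hc (phi τ.1 a)).symm
  obtain ⟨x1, hx1, hs1⟩ := exists_mem_cornerGraph_hasSym S c.1 0
  obtain ⟨x2, hx2, hs2⟩ := exists_mem_cornerGraph_hasSym S c.1 1
  have hX : (MvPolynomial.X 0 ^ (Fintype.card G - 1) : PolyXY) ≠ 0 :=
    pow_ne_zero _ (MvPolynomial.X_ne_zero _)
  obtain ⟨D, hD⟩ := SymbolRep.exists_degLE S x1.2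
  -- The bound `d` comes from the exchange identity $\theta(w)x_1=w\,\theta(x_1)$: the symbol of
  -- `x1.1` is right-cancellable, so $\deg\theta(w)+N\le\deg w+D$.
  obtain ⟨z, hz⟩ := exists_eq_mul (S := S) (fun x hx a => cornerGraph_mul_right a hx) hx1 hx2
    hs1 hs2 (d := D - (Fintype.card G - 1 : ℕ)) (by
      intro x hx k hk
      by_cases h0 : x.2 = 0
      · rw [h0]
        exact (SymbolRep.HasSym.zero _).degLE
      obtain ⟨l, b, hb, -, hs⟩ := S.exists_hasSym_ne_zero h0
      have h3 := hs.mul hs1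
      rw [cornerGraph_exchange h1 h2 hc' hx hx1] at h3
      refine hs.degLE.mono ?_
      by_contra hlt
      exact hb (mul_single_one_eq_zero hX (h3.eq_zero_of_degLE (hk.mul hD) (by omega))))
  refine ⟨z, fun a => ?_, ?_⟩
  · have h3 := hz _ (cornerGraph_mul_left a hx1)
    have h4 := hz _ hx1
    -- Left linearity gives $zax_1=\theta(ax_1)=a\,\theta(x_1)=azx_1$, and $x_1$ can be cancelled.
    refine sub_eq_zero.1 (mul_right_injective_of_hasSym hX hs1 ?_)
    simp only at h3
    rw [sub_mul, mul_assoc, ← h4, h3, mul_assoc, sub_self]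
  · have h3 := hz _ (cornerGraph_mem c.1 1 1)
    simpa using h3.symm

/-- A central `z` with $ze=0$ annihilates $AeA$, which contains a right-cancellable element. -/
theorem eq_zero_of_mul_idem_eq_zero (τ : Subalgebra.center ℂ[X] (MonoidAlgebra ℂ[X] G))
    {z : AlgA τ.1} (hz : ∀ a, z * a = a * z) (h : z * idem τ.1 = 0) : z = 0 := by
  obtain ⟨S⟩ := nonempty_polySymbolRep τ
  -- Only the first coordinate of the graph matters here, so $c=0$ is an arbitrary choice.
  obtain ⟨x, hx, hs⟩ := exists_mem_cornerGraph_hasSym S (0 : AlgA τ.1) 0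
  exact mul_right_injective_of_hasSym (pow_ne_zero _ (MvPolynomial.X_ne_zero _)) hs
    (mul_fst_eq_zero hz h hx)

theorem eq_of_mul_idem_eq (τ : Subalgebra.center ℂ[X] (MonoidAlgebra ℂ[X] G))
    {z w : AlgA τ.1} (hz : ∀ a, z * a = a * z) (hw : ∀ a, w * a = a * w)
    (h : z * idem τ.1 = w * idem τ.1) : z = w := by
  refine sub_eq_zero.1 (eq_zero_of_mul_idem_eq_zero τ (fun a => ?_) ?_)
  · rw [sub_mul, mul_sub, hz, hw]
  · rw [sub_mul, h, sub_self]

end Lift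

theorem phi_val_of_central {τ : MonoidAlgebra ℂ[X] G} {z : AlgA τ} (hz : ∀ a, a * z = z * a) :
    (phi τ z).1 = z * idem τ := by
  change idem τ * z * idem τ = _
  rw [hz, mul_assoc, (idem_isIdempotent τ).eq]

/-- The map `φ` on the centre of `A^τ`. -/
def phiCenter (τ : MonoidAlgebra ℂ[X] G) :
    Subalgebra.center ℂ[X] (AlgA τ) →ₐ[ℂ[X]] Subalgebra.center ℂ[X] (AlgC τ) where
  toFun z := ⟨phi τ z.1, by
    rw [Subalgebra.mem_center_iff]
    intro b
    have hz := Subalgebra.mem_center_iff.1 z.2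
    obtain ⟨h1, h2⟩ := (Subsemigroup.mem_corner_iff (idem_isIdempotent τ)).mp b.2
    apply Subtype.ext
    change b.1 * (phi τ z.1).1 = (phi τ z.1).1 * b.1
    rw [phi_val_of_central hz, mul_assoc, h1, ← mul_assoc, hz, mul_assoc, h2]⟩
  map_one' := by
    apply Subtype.ext
    apply Subtype.ext
    change (phi τ 1).1 = idem τ
    rw [phi_val_of_central (by simp), one_mul]
  map_mul' z w := by
    have hz := Subalgebra.mem_center_iff.1 z.2
    have hw := Subalgebra.mem_center_iff.1 w.2
    apply Subtype.ext
    apply Subtype.ext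
    change (phi τ (z.1 * w.1)).1 = (phi τ z.1).1 * (phi τ w.1).1
    rw [phi_val_of_central hz, phi_val_of_central hw,
      phi_val_of_central (fun a => by rw [← mul_assoc, hz, mul_assoc, hw, mul_assoc]),
      mul_assoc z.1 (idem τ), ← mul_assoc (idem τ) w.1, hw (idem τ), mul_assoc w.1,
      (idem_isIdempotent τ).eq, mul_assoc]
  map_zero' := by
    apply Subtype.ext
    apply Subtype.ext
    change (phi τ 0).1 = 0
    rw [phi_val_of_central (by simp), zero_mul]
  map_add' z w := by
    apply Subtype.ext
    apply Subtype.ext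
    change idem τ * (z.1 + w.1) * idem τ = idem τ * z.1 * idem τ + idem τ * w.1 * idem τ
    rw [mul_add, add_mul]
  commutes' r := by
    apply Subtype.ext
    apply Subtype.ext
    change (phi τ (algebraMap ℂ[X] (AlgA τ) r)).1 = r • idem τ
    rw [phi_val_of_central fun a => (Algebra.commutes r a).symm, Algebra.smul_def]

theorem phiCenter_bijective (τ : Subalgebra.center ℂ[X] (MonoidAlgebra ℂ[X] G)) :
    Function.Bijective (phiCenter τ.1) := by
  constructor
  · intro z w h
    have hz := Subalgebra.mem_center_iff.1 z.2
    have hw := Subalgebra.mem_center_iff.1 w.2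
    have h1 : (phi τ.1 z.1).1 = (phi τ.1 w.1).1 := congrArg (fun x => x.1.1) h
    rw [phi_val_of_central hz, phi_val_of_central hw] at h1
    exact Subtype.ext (eq_of_mul_idem_eq τ (fun a => (hz a).symm) (fun a => (hw a).symm) h1)
  · intro c
    obtain ⟨z, hz, hzc⟩ := exists_central_lift τ c.1 (Subalgebra.mem_center_iff.1 c.2)
    refine ⟨⟨z, Subalgebra.mem_center_iff.2 hz⟩, Subtype.ext (Subtype.ext ?_)⟩
    change (phi τ.1 z).1 = c.1.1
    rw [phi_val_of_central hz, hzc]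

end Centre

end CBH
end

theorem mainTheorem8 (G : Subgroup (Matrix.SpecialLinearGroup (Fin 2) ℂ)) [Fintype G]
    (τ : Subalgebra.center (Polynomial ℂ) (MonoidAlgebra (Polynomial ℂ) G)) :
    (∃ Ψ : Subalgebra.center (Polynomial ℂ) (CBH.AlgA τ.1) ≃ₐ[Polynomial ℂ]
        Subalgebra.center (Polynomial ℂ) (CBH.AlgC τ.1),
      ∀ z : Subalgebra.center (Polynomial ℂ) (CBH.AlgA τ.1),
        (Ψ z : CBH.AlgC τ.1) = CBH.phi τ.1 z.1) ∧
    ∀ (n : ℕ) (δ : Fin (n + 1) → ℕ) [∀ i, NeZero (δ i)]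
      (Φ : MonoidAlgebra ℂ G ≃ₐ[ℂ] Π i, Matrix (Fin (δ i)) (Fin (δ i)) ℂ),
      ∑ i, (δ i : Polynomial ℂ) * (CBH.centerEquiv Φ).symm τ i = 0 →
      (∀ a b : CBH.AlgC τ.1, a * b = b * a) ∧
      ∃ Ψ : Subalgebra.center (Polynomial ℂ) (CBH.AlgA τ.1) ≃ₐ[Polynomial ℂ] CBH.AlgC τ.1,
        ∀ z : Subalgebra.center (Polynomial ℂ) (CBH.AlgA τ.1), Ψ z = CBH.phi τ.1 z.1 := by
  refine ⟨⟨AlgEquiv.ofBijective _ (CBH.phiCenter_bijective τ), fun z => rfl⟩, ?_⟩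
  intro n δ _ Φ hsum
  have hcomm := CBH.commute_of_coeff_one_eq_zero τ (CBH.coeff_one_eq_zero_of_sum_eq_zero Φ τ hsum)
  refine ⟨hcomm, AlgEquiv.ofBijective ((Subalgebra.val _).comp (CBH.phiCenter τ.1)) ⟨?_, ?_⟩,
    fun z => rfl⟩
  · exact Subtype.val_injective.comp (CBH.phiCenter_bijective τ).1
  · intro c
    obtain ⟨z, hz⟩ := (CBH.phiCenter_bijective τ).2
      ⟨c, Subalgebra.mem_center_iff.2 fun b => hcomm b c⟩
    exact ⟨z, congrArg Subtype.val hz⟩
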